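/- **Trees.** For a set $\Lambda$, order the finite sequences in $\Lambda$ by $s\prec t$ iff $s$ is a proper initial segment of $t$. For a set $S$ of finite sequences, $MAX(S)$ is the set of its $\prec$-maximal members; put $S^0=S$, $S^{\zeta+1}=S^\zeta\setminus MAX(S^\zeta)$ and $S^\zeta=\bigcap_{\eta<\zeta}S^\eta$ for limit $\zeta$, and let $o(S)$ be the least $\zeta$ with $S^\zeta=\varnothing$, if there is one. A $B$-tree is a set $B$ of non-empty finite sequences such that $B\cup\{\varnothing\}$ is closed under initial segments. A collection $(x_t)_{t\in B}$ in a Banach space $X$ is weakly null if for every ordinal $\zeta$ and every $t\in(B\cup\{\varnothing\})^{\zeta+1}$, $0$ is in the weak closure of $\{x_s: s\in B^\zeta,\ s \text{ extends } t \text{ by one term}\}$. **Smoothness.** Let $A:X\to Y$ be a bounded linear operator between (real or complex) Banach spaces and $\xi$ an ordinal. For $\sigma\geq 0$ let $$\rho_\xi(\sigma;A)=\sup\ \inf\{\|y+Ax\|-1: t\in B,\ x\in\mathrm{co}(x_s:s\preceq t)\},$$ the supremum being over $y\in B_Y$, $B$-trees $B$ with $o(B)=\omega^\xi$ and weakly null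 $(x_t)_{t\in B}\subset\sigma B_X$. For $1<p<\infty$, $A$ is $\xi$-AUS with power type $p$ if there is $C$ with $\rho_\xi(\sigma;A)\le C\sigma^p$ for all $0<\sigma\le1$, and $\mathbf t_{\xi,p}(A)$ is the infimum of those $C>0$ such that $$\inf\{\|y+Ax\|^p: t\in B,\ x\in\mathrm{co}(x_s:s\preceq t)\}\le\|y\|^p+C\sigma^p$$ for all $y\in Y$, $\sigma>0$, all $B$-trees $B$ with $o(B)=\omega^\xi$ and all weakly null $(x_t)_{t\in B}\subset\sigma B_X$. For $p=\infty$, $\mathbf t_{\xi,\infty}(A)$ is defined in the same way through $$\inf\{\|y+Ax\|: t\in B,\ x\in\mathrm{co}(x_s:s\preceq t)\}\le\max\{\|y\|,C\sigma\},$$ and $A$ is $\xi$-AUS with power type $\infty$ if some constant $C$ has this property. **Special trees and weights.** For an ordinal $\zeta$ and a sequence of ordinals, $\zeta+(\zeta_i)=(\zeta+\zeta_i)$. Let $\Gamma_0=\{(0)\}$; let $\Gamma_{\xi,1}=\Gamma_\xi$, $$\Gamma_{\xi,n+1}=(\omega^\xi n+\Gamma_\xi)\cup\{t^\frown u: t\in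 MAX(\omega^\xi n+\Gamma_\xi),\ u\in\Gamma_{\xi,n}\},$$ $\Gamma_{\xi+1}=\bigcup_{n\geq1}\Gamma_{\xi,n}$; and $\Gamma_\xi=\bigcup_{\zeta<\xi}(\omega^\zeta+\Gamma_{\zeta+1})$ for limit $\xi$. These unions are disjoint. Level $n\geq1$ of $\Gamma_{\xi,\infty}$ consists of the sequences $t_1{}^\frown(\omega^\xi+t_2)^\frown\cdots{}^\frown(\omega^\xi(n-1)+t_n)$ with $t_i\in\Gamma_\xi$ for $i\le n$ and $t_i\in MAX(\Gamma_\xi)$ for $i<n$; $\Gamma_{\xi,\infty}$ is the union of its levels, and $\iota_{\xi,\infty}$ maps such a sequence to $t_n\in\Gamma_\xi$. Members of $\Gamma_{\xi,n}$ are likewise concatenations of blocks $\omega^\xi j+u_j$ with $u_j\in\Gamma_\xi$, and $\iota_{\xi,n}$ maps such a member to the $u_j$ of its last block. The weights $\mathbb P_\xi:\Gamma_\xi\to[0,1]$ are given by $\mathbb P_0((0))=1$; $\mathbb P_{\xi+1}(t)=\frac1n\mathbb P_\xi(\iota_{\xi,n}(t))$ for $t\in\Gamma_{\xi,n}$; and,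 for limit $\xi$, $\mathbb P_\xi(\omega^\zeta+t')=\mathbb P_{\zeta+1}(t')$ for $\zeta<\xi$ and $t'\in\Gamma_{\zeta+1}$. For a set $D$, let $\Omega_{\xi,\infty}$ be the set of all sequences $(\zeta_i,U_i)_{i=1}^m$ with $(\zeta_i)_{i=1}^m\in\Gamma_{\xi,\infty}$ and $U_i\in D$; let $\Lambda_{\xi,\infty,n}$ be its level $n$ (those with $(\zeta_i)_{i=1}^m$ on level $n$), and extend $\mathbb P_\xi\circ\iota_{\xi,\infty}$ to $\Omega_{\xi,\infty}$ by ignoring the $U_i$. If $D$ is a neighborhood basis at $0$ for the weak topology of $X$, a collection $(x_t)_{t\in\Omega_{\xi,\infty}}\subset X$ is normally weakly null if $x_t\in U$ whenever $(\zeta,U)$ is the last term of $t$. **Statement.** Let $\xi$ be an ordinal, $1<p\le\infty$, $A:X\to Y$ a bounded linear operator between Banach spaces that is $\xi$-AUS with power type $p$, and $D$ a weak neighborhood basis at $0$ in $X$. Let $C_1>\mathbf t_{\xi,p}(A)^{1/p}$ if $p<\infty$, and $C_1>\mathbf t_{\xi,\infty}(A)$ if $p=\infty$. Then for every normally weakly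 null $(x_t)_{t\in\Omega_{\xi,\infty}}\subset B_X$ there is a sequence $\varnothing=t_0\prec t_1\prec t_2\prec\cdots$ with $t_n\in MAX(\Lambda_{\xi,\infty,n})$ for all $n\ge1$, such that, with $$z_n=\sum_{t_{n-1}\prec t\preceq t_n}\mathbb P_\xi(\iota_{\xi,\infty}(t))\,x_t\in\mathrm{co}(x_t:t_{n-1}\prec t\preceq t_n)\qquad(n\geq1),$$ the sequence $(Az_n)_{n\ge1}$ is $C_1$-dominated by the $\ell_p$ basis (the $c_0$ basis if $p=\infty$). That is, $\|\sum_{i=1}^n a_iAz_i\|\le C_1\|(a_i)_{i=1}^n\|_{\ell_p^n}$ for all $n$ and all scalars $a_1,\dots,a_n$. -/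

import Mathlib

open scoped Ordinal Topology

universe w u v k

noncomputable section

namespace XiAUS

/-! ## Trees of finite sequences -/

section Trees

variable {Λ : Type u}

/-- `s ≺ t`: the finite sequence `s` is a proper initial segment of `t`. -/
def ProperInit (s t : List Λ) : Prop := s <+: t ∧ s ≠ t

/-- `MAX(S)`: the `≺`-maximal members of `S`. -/
def maxSet (S : Set (List Λ)) : Set (List Λ) := {t | t ∈ S ∧ ∀ s ∈ S, ¬ ProperInit t s}

/-- A tree is a set of finite sequences that is closed under initial segments. -/
def IsTree (T : Set (List Λ)) : Prop := ∀ t ∈ T, ∀ s, s <+: t → s ∈ T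

/-- A `B`-tree is a set `B` of non-empty finite sequences such that `B ∪ {∅}` is a tree. -/
def IsBTree (B : Set (List Λ)) : Prop := [] ∉ B ∧ IsTree (B ∪ {[]})

/-- The derived sets `T^ζ`: `T^0 = T`, `T^(ζ+1) = T^ζ \ MAX(T^ζ)`, intersections at limits. -/
def derivedTree (T : Set (List Λ)) (ζ : Ordinal.{w}) : Set (List Λ) :=
  Ordinal.limitRecOn ζ T (fun _ S => S \ maxSet S) (fun ζ _ IH => ⋂ η, ⋂ h : η < ζ, IH η h)

/-- `o(T) = α`: `T` is well-founded and `α` is the least ordinal with `T^α = ∅`. (For a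
well-founded `T` this is also the least `α` with `T^α = T^(α+1)`, as the derived sets are
strictly decreasing until they are empty.) -/
def HasOrder (T : Set (List Λ)) (α : Ordinal.{w}) : Prop :=
  IsLeast {ζ : Ordinal.{w} | derivedTree T ζ = ∅} α

/-- `S D`: the sequences of pairs `(ζ_i, U_i)` with `(ζ_i) ∈ S` and `U_i ∈ D`. -/
def prodTree (S : Set (List Λ)) (D : Type v) : Set (List (Λ × D)) := {t | t.map Prod.fst ∈ S}

end Trees

/-! ## Weakly null collections, asymptotic uniform smoothness -/

section Smoothness

variable (𝕜 : Type k) [RCLike 𝕜] {X : Type u} [NormedAddCommGroup X] [NormedSpace 𝕜 X]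
  {Y : Type v} [NormedAddCommGroup Y] [NormedSpace 𝕜 Y]

/-- The (real) convex hull of a subset of a real or complex vector space. -/
def co (S : Set X) : Set X :=
  letI : Module ℝ X := Module.compHom X (algebraMap ℝ 𝕜)
  convexHull ℝ S

/-- The union over `t ∈ B` of the sets `co (x_s : s ≼ t)`. -/
def branchHull {Λ : Type*} (B : Set (List Λ)) (x : List Λ → X) : Set X :=
  {v | ∃ t ∈ B, v ∈ co 𝕜 (x '' {s | s ∈ B ∧ s <+: t})}

/-- The collection `(x_t)_{t ∈ B}` is weakly null: for every ordinal `ζ` and every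
`t ∈ (B ∪ {∅})^(ζ+1)`, zero is in the weak closure of `{x_s : s ∈ B^ζ, s^- = t}`. -/
def IsWeaklyNull.{w', u', k', l'} (𝕜 : Type k') [RCLike 𝕜] {X : Type u'} [NormedAddCommGroup X]
    [NormedSpace 𝕜 X] {Λ : Type l'} (B : Set (List Λ)) (x : List Λ → X) : Prop :=
  ∀ ζ : Ordinal.{w'}, ∀ t ∈ derivedTree (B ∪ {[]}) (ζ + 1),
    (0 : WeakSpace 𝕜 X) ∈
      closure ((fun s => toWeakSpace 𝕜 X (x s)) '' {s | s ∈ derivedTree B ζ ∧ ∃ a, s = t ++ [a]})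

/-- `B` is a `B`-tree of order `ω^ξ` and `(x_t)_{t ∈ B}` is a weakly null collection in `σ B_X`. -/
def IsNullTree {Λ : Type*} (ξ : Ordinal.{w}) (σ : ℝ) (B : Set (List Λ)) (x : List Λ → X) : Prop :=
  IsBTree B ∧ HasOrder B (ω ^ ξ) ∧ IsWeaklyNull.{w} 𝕜 B x ∧ ∀ s ∈ B, ‖x s‖ ≤ σ

variable {𝕜}

/-- The modulus `ρ_ξ(σ; A)` of `ξ`-asymptotic uniform smoothness. The labels of the `B`-trees
range over all sets of a universe that contains the ordinals below `ω^ξ` and the subsets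
of `X`. -/
def rho (ξ : Ordinal.{w}) (A : X →L[𝕜] Y) (σ : ℝ) : EReal :=
  sSup {r : EReal | ∃ (Λ : Type (max u (w + 1))) (B : Set (List Λ)) (x : List Λ → X) (y : Y),
    IsNullTree 𝕜 ξ σ B x ∧ ‖y‖ ≤ 1 ∧
      r = ((sInf ((fun v => ‖y + A v‖ - 1) '' branchHull 𝕜 B x) : ℝ) : EReal)}

/-- For all `y`, all `σ > 0` and all weakly null `(x_t)_{t ∈ B} ⊂ σ B_X` with `o(B) = ω^ξ`,
`inf ‖y + A x‖^p ≤ ‖y‖^p + C σ^p`, the infimum over `x ∈ co (x_s : s ≼ t)`, `t ∈ B`. -/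
def SmoothEstimate (ξ : Ordinal.{w}) (p : ℝ) (A : X →L[𝕜] Y) (C : ℝ) : Prop :=
  ∀ (Λ : Type (max u (w + 1))) (B : Set (List Λ)) (x : List Λ → X) (y : Y) (σ : ℝ), 0 < σ →
    IsNullTree 𝕜 ξ σ B x →
      sInf ((fun v => ‖y + A v‖ ^ p) '' branchHull 𝕜 B x) ≤ ‖y‖ ^ p + C * σ ^ p

/-- The analogue for `p = ∞`: `inf ‖y + A x‖ ≤ max {‖y‖, C σ}`. -/
def SmoothEstimateTop (ξ : Ordinal.{w}) (A : X →L[𝕜] Y) (C : ℝ) : Prop :=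
  ∀ (Λ : Type (max u (w + 1))) (B : Set (List Λ)) (x : List Λ → X) (y : Y) (σ : ℝ), 0 < σ →
    IsNullTree 𝕜 ξ σ B x →
      sInf ((fun v => ‖y + A v‖) '' branchHull 𝕜 B x) ≤ max ‖y‖ (C * σ)

/-- `A` is `ξ`-AUS with power type `p`, for `1 < p ≤ ∞`. -/
def IsAUSPowerType (ξ : Ordinal.{w}) (p : ENNReal) (A : X →L[𝕜] Y) : Prop :=
  if p = ⊤ then ∃ C : ℝ, SmoothEstimateTop ξ A C
  else ∃ C : ℝ, ∀ σ : ℝ, 0 < σ → σ ≤ 1 → rho ξ A σ ≤ ((C * σ ^ p.toReal : ℝ) : EReal)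

/-- The constant `t_{ξ,p}(A)`, for `1 < p ≤ ∞`. -/
def tConst (ξ : Ordinal.{w}) (p : ENNReal) (A : X →L[𝕜] Y) : ENNReal :=
  sInf {c : ENNReal | ∃ C : ℝ, 0 < C ∧ c = ENNReal.ofReal C ∧
    if p = ⊤ then SmoothEstimateTop ξ A C else SmoothEstimate ξ p.toReal A C}

/-- `(v_n)` is `C`-dominated by the `ℓ_p` basis (the `c_0` basis if `p = ∞`):
`‖∑ a_i v_i‖ ≤ C ‖(a_i)‖_p` for all finite scalar sequences. -/
def Dominated (𝕜 : Type k) [RCLike 𝕜] {Y : Type v} [NormedAddCommGroup Y] [NormedSpace 𝕜 Y]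
    (p : ENNReal) (C : ℝ) (v : ℕ → Y) : Prop :=
  ∀ (n : ℕ) (a : Fin n → 𝕜),
    ‖∑ i, a i • v i‖ ≤ C * ‖(WithLp.toLp p a : PiLp p (fun _ : Fin n => 𝕜))‖

end Smoothness

/-! ## The trees `Γ_ξ`, `Γ_{ξ,n}`, `Γ_{ξ,∞}` and the weights `ℙ_ξ` -/

section Gamma

/-- `ζ + (ζ_i) = (ζ + ζ_i)`. -/
def shift (ζ : Ordinal.{w}) (t : List Ordinal.{w}) : List Ordinal.{w} := t.map (fun a => ζ + a)

/-- With `G = Γ_ξ`, this is `Γ_{ξ,n}`: `Γ_{ξ,1} = Γ_ξ` and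
`Γ_{ξ,n+1} = (ω^ξ n + Γ_ξ) ∪ {t ⌢ u : t ∈ MAX(ω^ξ n + Γ_ξ), u ∈ Γ_{ξ,n}}`; it is empty for
`n = 0`. -/
def gammaAux (ξ : Ordinal.{w}) (G : Set (List Ordinal.{w})) : ℕ → Set (List Ordinal.{w})
  | 0 => ∅
  | n + 1 => (shift (ω ^ ξ * n) '' G) ∪
      {r | ∃ t ∈ maxSet (shift (ω ^ ξ * n) '' G), ∃ u ∈ gammaAux ξ G n, r = t ++ u}

/-- `Γ_0 = {(0)}`, `Γ_{ξ+1} = ⋃ n, Γ_{ξ,n}`, and `Γ_ξ = ⋃ ζ < ξ, (ω^ζ + Γ_{ζ+1})` for limit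
ordinals `ξ`. -/
def gammaTree (ξ : Ordinal.{w}) : Set (List Ordinal.{w}) :=
  Ordinal.limitRecOn ξ {[0]} (fun ξ G => ⋃ n, gammaAux ξ G n)
    (fun ξ hξ IH => ⋃ ζ, ⋃ h : ζ < ξ, shift (ω ^ ζ) '' IH (ζ + 1) (hξ.add_one_lt h))

/-- `Γ_{ξ,n}`. -/
def gammaN (ξ : Ordinal.{w}) (n : ℕ) : Set (List Ordinal.{w}) := gammaAux ξ (gammaTree ξ) n

/-- Level `n` of `Γ_{ξ,∞}`: the sequences `t_1 ⌢ (ω^ξ + t_2) ⌢ ⋯ ⌢ (ω^ξ (n-1) + t_n)` with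
`t_i ∈ Γ_ξ`, and `t_i ∈ MAX(Γ_ξ)` for `i < n`. Level `0` is `{∅}`. -/
def gammaInfLevel (ξ : Ordinal.{w}) : ℕ → Set (List Ordinal.{w})
  | 0 => {[]}
  | n + 1 => {r | ∃ s ∈ maxSet (gammaInfLevel ξ n), ∃ u ∈ gammaTree ξ, r = s ++ shift (ω ^ ξ * n) u}

/-- `Γ_{ξ,∞}`. -/
def gammaInf (ξ : Ordinal.{w}) : Set (List Ordinal.{w}) := ⋃ n : ℕ, gammaInfLevel ξ (n + 1)

/-- The identification of a unit with `Γ_ξ`. A member of `Γ_{ξ,n}` or of `Γ_{ξ,∞}` is a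
concatenation of blocks `ω^ξ j + t_j` with `t_j ∈ Γ_ξ ⊂ [0, ω^ξ)^{<ℕ}` and distinct `j < ω`;
its image is `t_j` for the last block: the entries with the same quotient by `ω^ξ` as the last
entry, reduced modulo `ω^ξ`. -/
def iota (ξ : Ordinal.{w}) (t : List Ordinal.{w}) : List Ordinal.{w} :=
  (t.filter (fun a => a / ω ^ ξ = (t.getLast?.getD 0) / ω ^ ξ)).map (fun a => a % ω ^ ξ)

/-- The weights `ℙ_ξ` on `Γ_ξ` (with a meaningless value off `Γ_ξ`). On `Γ_0` the weight is `1`.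
On `Γ_{ξ,n} ⊂ Γ_{ξ+1}` (for exactly one `n`) it is `ℙ_{ξ+1}(t) = ℙ_ξ(ι_{ξ,n}(t)) / n`. If `ξ` is a
limit ordinal and `t = ω^ζ + t'` with `t' ∈ Γ_{ζ+1}` (for exactly one `ζ < ξ`),
then `ℙ_ξ(t) = ℙ_{ζ+1}(t')`. -/
def weight (ξ : Ordinal.{w}) : List Ordinal.{w} → ℝ :=
  Ordinal.limitRecOn (motive := fun _ => List Ordinal.{w} → ℝ) ξ (fun _ => 1)
    (fun ξ P t => ((sInf {n : ℕ | t ∈ gammaN ξ n} : ℕ) : ℝ)⁻¹ * P (iota ξ t))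
    (fun ξ _ IH t =>
      let ζ := sInf {ζ : Ordinal.{w} | ζ < ξ ∧ t ∈ shift (ω ^ ζ) '' gammaTree (ζ + 1)}
      open Classical in
      if h : ζ + 1 < ξ then IH (ζ + 1) h (t.map (fun a => a - ω ^ ζ)) else 0)

end Gamma

/-! ## Collections indexed by `Ω_{ξ,∞} = Γ_{ξ,∞} D` -/

section Omega

/-- `Ω_{ξ,∞} = Γ_{ξ,∞} D`. -/
def omegaInf (ξ : Ordinal.{w}) (D : Type u) : Set (List (Ordinal.{w} × D)) :=
  prodTree (gammaInf ξ) D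

/-- `Λ_{ξ,∞,n}`: level `n ≥ 1` of `Ω_{ξ,∞}`. -/
def omegaInfLevel (ξ : Ordinal.{w}) (D : Type u) (n : ℕ) : Set (List (Ordinal.{w} × D)) :=
  prodTree (gammaInfLevel ξ n) D

/-- `(x_t)_{t ∈ Ω_{ξ,∞}}` is normally weakly null: `x_t ∈ U` if `(ζ, U)` is the last entry
of `t`. -/
def NormallyWeaklyNull (𝕜 : Type k) [RCLike 𝕜] {X : Type u} [NormedAddCommGroup X]
    [NormedSpace 𝕜 X] (ξ : Ordinal.{w}) {D : Set (Set (WeakSpace 𝕜 X))}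
    (x : List (Ordinal.{w} × D) → X) : Prop :=
  ∀ t ∈ omegaInf ξ D, ∀ (s : List (Ordinal.{w} × D)) (ζ : Ordinal.{w}) (U : D),
    t = s ++ [(ζ, U)] → toWeakSpace 𝕜 X (x t) ∈ U.1

/-- The vector `∑_{s ≺ r ≼ t} ℙ_ξ(ι_{ξ,∞}(r)) x_r`, for `s ≼ t`; the sequences `r` with
`s ≺ r ≼ t` are the initial segments of `t` of length greater than `|s|`. -/
def specialSum (𝕜 : Type k) [RCLike 𝕜] {X : Type u} [NormedAddCommGroup X]
    [NormedSpace 𝕜 X] (ξ : Ordinal.{w}) {D : Type v} (x : List (Ordinal.{w} × D) → X)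
    (s t : List (Ordinal.{w} × D)) : X :=
  ∑ j ∈ Finset.Ioc s.length t.length,
    ((weight ξ (iota ξ ((t.take j).map Prod.fst)) : ℝ) : 𝕜) • x (t.take j)

end Omega

end XiAUS

end

open XiAUS

noncomputable section

namespace XiAUS

open Filter

/-! ## An extension game for families of nodes -/

section Game

variable {D : Type u}

/-! The sequence is built block by block. The whole problem is one block: if $Az_1,\dots,Az_n$ are
dominated with constant $K_1$ and $K_2>K_1$, the next copy of $\Gamma_\xi D$ must contain a full
branch whose special convex combination keeps the constant below $K_2$ for all scalars. The
smoothness estimate only yields some convex combination on some branch of a weakly null tree of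
order $\omega^\xi$, for one vector $y$; here the weights $\mathbb P_\xi$ are prescribed and one
branch has to serve all scalars.

Both difficulties are met by an ultrafilter $V$ on the full branches of $\Gamma_\xi D$
(`exists_isSpecial`), depending only on $\xi$ and on an ultrafilter of labels shrinking to $0$. Its
property `Spread` is this: if a bounded $f(s,t)$ has $\mathbb P_\xi$-averages above $\tau>c$ along
$V$-almost every branch $t$, then sets of nodes $s$ of a common branch $t$ with $f(s,t)>c$ can be
enlarged $\omega^\xi$ times, in the sense of an ordinal game. The proof is by induction on $\xi$. At
a successor, $V$ concatenates $n$ independent branches for a random unbounded $n$; a large average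
forces many good blocks (`MultiSpread.concat`), each contributing $\omega^\xi$ moves, and so
$\omega^\xi\cdot\omega$ in all.

If $\|y+\sigma Az_t\|\ge c$ held for $V$-almost every $t$, with $z_t$ the special combination on
$t$, then norming functionals $g_t$ would give such an $f$. The game, played along decreasing
sequences of ordinals (`Extendable.exists_tree`), would then produce a weakly null tree of order
$\omega^\xi$ each of whose finite branches is kept large by a single $g_t$, and hence so are all its
convex combinations. This contradicts smoothness, so the desired bound holds $V$-almost surely
(`IsSpecial.eventually_norm_lt`). Finitely many almost sure bounds hold together, and compactness of
the unit sphere of scalars yields all of them at once (`IsSpecial.eventually_dominated`). -/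

/-- The last term of `s` has its label in `E`. -/
def LastIn (E : Set D) (s : List (Ordinal.{w} × D)) : Prop := ∃ r a, s = r ++ [a] ∧ a.2 ∈ E

/-- `S` belongs to `𝒞`, and for every `β < α` and every `E ∈ 𝒰` it can be enlarged by a node
whose last label is in `E` to a set with the same property for `β` in place of `α`. -/
def Extendable (𝒰 : Filter D) (𝒞 : Set (Set (List (Ordinal.{w} × D)))) (α : Ordinal.{w})
    (S : Set (List (Ordinal.{w} × D))) : Prop :=
  S ∈ 𝒞 ∧ ∀ β, ∀ _ : β < α, ∀ E ∈ 𝒰, ∃ s, LastIn E s ∧ Extendable 𝒰 𝒞 β (insert s S)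
termination_by α

variable {𝒰 : Filter D} {𝒞 𝒞' : Set (Set (List (Ordinal.{w} × D)))} {α γ : Ordinal.{w}}
  {S S₀ : Set (List (Ordinal.{w} × D))}

theorem extendable_iff : Extendable 𝒰 𝒞 α S ↔
    S ∈ 𝒞 ∧ ∀ β < α, ∀ E ∈ 𝒰, ∃ s, LastIn E s ∧ Extendable 𝒰 𝒞 β (insert s S) := by
  rw [Extendable]

theorem Extendable.mem (h : Extendable 𝒰 𝒞 α S) : S ∈ 𝒞 := (extendable_iff.1 h).1

theorem extendable_zero (h : S ∈ 𝒞) : Extendable 𝒰 𝒞 0 S :=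
  extendable_iff.2 ⟨h, fun β hβ => absurd hβ (not_lt_of_ge (zero_le : 0 ≤ β))⟩

/-- The first move only names some $\beta<\alpha$, so a possibly different $\gamma>\beta$ may answer
each $\beta$. This is how limits such as $\alpha\cdot\omega$ are reached. -/
theorem extendable_of_forall_lt (hS : S ∈ 𝒞)
    (h : ∀ β < α, ∃ γ, β < γ ∧ Extendable 𝒰 𝒞 γ S) : Extendable 𝒰 𝒞 α S := by
  refine extendable_iff.2 ⟨hS, fun β hβ E hE => ?_⟩
  obtain ⟨γ, hβγ, hγ⟩ := h β hβ
  exact (extendable_iff.1 hγ).2 β hβγ E hE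

/-- A strategy is transported along `φ`, while the nodes `S₀` chosen earlier are carried along
unchanged. -/
theorem Extendable.map {φ : List (Ordinal.{w} × D) → List (Ordinal.{w} × D)}
    (hφ : ∀ E s, LastIn E s → LastIn E (φ s))
    (h𝒞 : ∀ S ∈ 𝒞, φ '' S ∪ S₀ ∈ 𝒞') (h : Extendable 𝒰 𝒞 α S) :
    Extendable 𝒰 𝒞' α (φ '' S ∪ S₀) := by
  induction α using WellFoundedLT.induction generalizing S with
  | ind α IH =>
    refine extendable_iff.2 ⟨h𝒞 S h.mem, fun β hβ E hE => ?_⟩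
    obtain ⟨s, hs, hs'⟩ := (extendable_iff.1 h).2 β hβ E hE
    refine ⟨φ s, hφ E s hs, ?_⟩
    have := IH β hβ hs'
    rwa [Set.image_insert_eq, Set.insert_union] at this

/-- Ranks fall from the right summand first: an ordinal below $\gamma+\alpha$ is either
$\gamma+\beta$ with $\beta<\alpha$, answered by the game for `𝒞`, or less than $\gamma$, when the
game for `𝒞'` takes over. -/
theorem Extendable.add (h𝒞 : ∀ S ∈ 𝒞, Extendable 𝒰 𝒞' γ S) (h : Extendable 𝒰 𝒞 α S) :
    Extendable 𝒰 𝒞' (γ + α) S := by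
  induction α using WellFoundedLT.induction generalizing S with
  | ind α IH =>
    have hγ := h𝒞 S h.mem
    refine extendable_iff.2 ⟨hγ.mem, fun δ hδ E hE => ?_⟩
    rcases lt_or_ge δ γ with hlt | hge
    · exact (extendable_iff.1 hγ).2 δ hlt E hE
    · obtain ⟨β, rfl⟩ := exists_add_of_le hge
      have hβ : β < α := (add_lt_add_iff_left γ).1 hδ
      obtain ⟨s, hs, hs'⟩ := (extendable_iff.1 h).2 β hβ E hE
      exact ⟨s, hs, IH β hβ hs'⟩

theorem LastIn.map {g : Ordinal.{w} × D → Ordinal.{w} × D} (hg : ∀ a, (g a).2 = a.2) (E : Set D)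
    (s : List (Ordinal.{w} × D)) (h : LastIn E s) : LastIn E (s.map g) := by
  obtain ⟨r, a, rfl, ha⟩ := h
  exact ⟨r.map g, g a, by simp, by rwa [hg]⟩

theorem LastIn.append (r : List (Ordinal.{w} × D)) (E : Set D)
    (s : List (Ordinal.{w} × D)) (h : LastIn E s) : LastIn E (r ++ s) := by
  obtain ⟨r', a, rfl, ha⟩ := h
  exact ⟨r ++ r', a, by simp, ha⟩

end Game

/-! ## Ultrafilters on branches -/

section Spread

variable {D : Type u}

/-- The sets of nodes `s` of a branch `t ∈ Q` on which `f s t` is greater than `c`. -/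
def branchFamily (f : List (Ordinal.{w} × D) → List (Ordinal.{w} × D) → ℝ) (c : ℝ)
    (Q : Set (List (Ordinal.{w} × D))) : Set (Set (List (Ordinal.{w} × D))) :=
  {S | ∃ t ∈ Q, ∀ s ∈ S, s <+: t ∧ s ≠ [] ∧ c < f s t}

/-- The sum of `W s * f s t` over the non-empty initial segments `s` of `t`. -/
def pathSum (W : List (Ordinal.{w} × D) → ℝ)
    (f : List (Ordinal.{w} × D) → List (Ordinal.{w} × D) → ℝ) (t : List (Ordinal.{w} × D)) : ℝ :=
  ∑ j ∈ Finset.Ioc 0 t.length, W (t.take j) * f (t.take j) t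

/-- If the weighted averages of a bounded function along almost every branch exceed some `τ > c`,
then sets of nodes on which the function exceeds `c` can be extended `α` times. -/
def Spread (𝒰 : Filter D) (V : Ultrafilter (List (Ordinal.{w} × D)))
    (W : List (Ordinal.{w} × D) → ℝ) (α : Ordinal.{w}) : Prop :=
  ∀ (f : List (Ordinal.{w} × D) → List (Ordinal.{w} × D) → ℝ) (M c τ : ℝ)
    (Q : Set (List (Ordinal.{w} × D))), (∀ s t, |f s t| ≤ M) → c < τ → Q ∈ V →
    (∀ᶠ t in V, τ < pathSum W f t) → Extendable 𝒰 (branchFamily f c Q) α ∅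

/-- The analogue of `Spread` for sums of `n` averages. -/
def MultiSpread (𝒰 : Filter D) (V : Ultrafilter (List (Ordinal.{w} × D)))
    (W : List (Ordinal.{w} × D) → ℝ) (α : Ordinal.{w}) (n : ℕ) : Prop :=
  ∀ (f : List (Ordinal.{w} × D) → List (Ordinal.{w} × D) → ℝ) (M c τ : ℝ)
    (Q : Set (List (Ordinal.{w} × D))) (m : ℕ), (∀ s t, |f s t| ≤ M) → c ≤ M →
    m * M + (n - m) * c < τ → Q ∈ V →
    (∀ᶠ t in V, τ < pathSum W f t) → Extendable 𝒰 (branchFamily f c Q) (α * m) ∅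

/-- The concatenation of a `V`-random and an independent `V'`-random sequence. -/
def concatUltra (V V' : Ultrafilter (List (Ordinal.{w} × D))) :
    Ultrafilter (List (Ordinal.{w} × D)) :=
  V.bind fun t => V'.map fun u => t ++ u

theorem eventually_concatUltra {V V' : Ultrafilter (List (Ordinal.{w} × D))}
    {P : List (Ordinal.{w} × D) → Prop} :
    (∀ᶠ t in concatUltra V V', P t) ↔ ∀ᶠ t in V, ∀ᶠ u in V', P (t ++ u) := Iff.rfl

theorem eventually_ultraBind {ι κ : Type*} {V : Ultrafilter ι} {V' : ι → Ultrafilter κ}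
    {P : κ → Prop} : (∀ᶠ t in V.bind V', P t) ↔ ∀ᶠ i in V, ∀ᶠ t in V' i, P t := Iff.rfl

theorem exists_ultralimit {ι : Type*} (V : Ultrafilter ι) {φ : ι → ℝ} {M : ℝ}
    (h : ∀ i, |φ i| ≤ M) : ∃ l, |l| ≤ M ∧ Tendsto φ V (𝓝 l) := by
  obtain ⟨l, hl, hl'⟩ := (isCompact_Icc (a := -M) (b := M)).ultrafilter_le_nhds (V.map φ)
    (by
      rw [Ultrafilter.coe_map, le_principal_iff, mem_map]
      exact Eventually.of_forall fun i => abs_le.1 (h i))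
  exact ⟨l, abs_le.2 hl, hl'⟩

theorem sum_Ioc_length_append_right {α E : Type*} [AddCommMonoid E] (F : List α → E)
    (a b : List α) : ∑ j ∈ Finset.Ioc a.length (a ++ b).length, F ((a ++ b).take j) =
      ∑ j ∈ Finset.Ioc 0 b.length, F (a ++ b.take j) := by
  rw [List.length_append]
  refine Finset.sum_nbij' (fun j => j - a.length) (fun j => a.length + j) ?_ ?_ ?_ ?_ ?_ <;>
    intro j hj <;> rw [Finset.mem_Ioc] at hj
  · rw [Finset.mem_Ioc]; omega
  · rw [Finset.mem_Ioc]; omega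
  · omega
  · omega
  · rw [List.take_append, List.take_of_length_le hj.1.le]

theorem sum_Ioc_length_append {α E : Type*} [AddCommMonoid E] (F : List α → E) (a b : List α) :
    ∑ j ∈ Finset.Ioc 0 (a ++ b).length, F ((a ++ b).take j) =
      ∑ j ∈ Finset.Ioc 0 a.length, F (a.take j) +
        ∑ j ∈ Finset.Ioc 0 b.length, F (a ++ b.take j) := by
  rw [← sum_Ioc_length_append_right,
    ← Finset.sum_Ioc_consecutive _ (Nat.zero_le _) (List.prefix_append a b).length_le]
  congr 1
  refine Finset.sum_congr rfl fun j hj => ?_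
  rw [List.take_append_of_le_length (Finset.mem_Ioc.1 hj).2]

theorem take_ne_nil {α : Type*} {t : List α} {j : ℕ} (hj : j ∈ Finset.Ioc 0 t.length) :
    t.take j ≠ [] := by
  rw [Finset.mem_Ioc] at hj
  rw [Ne, List.take_eq_nil_iff]
  rintro (h | rfl)
  · omega
  · simp at hj; omega

variable {𝒰 : Filter D} {V V' : Ultrafilter (List (Ordinal.{w} × D))}
  {W W' W'' : List (Ordinal.{w} × D) → ℝ} {α : Ordinal.{w}}

theorem Spread.map (h : Spread 𝒰 V W α) {g : Ordinal.{w} × D → Ordinal.{w} × D}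
    (hg : ∀ a, (g a).2 = a.2)
    (hW : ∀ᶠ t : List (Ordinal.{w} × D) in V,
      ∀ j ∈ Finset.Ioc 0 t.length, W' ((t.take j).map g) = W (t.take j)) :
    Spread 𝒰 (V.map (List.map g)) W' α := by
  intro f M c τ Q hf hcτ hQ hτ
  have := h (fun s t => f (s.map g) (t.map g)) M c τ _ (fun s t => hf _ _) hcτ hQ (by
    have hτ' : ∀ᶠ t in V, τ < pathSum W' f (List.map g t) := hτ
    filter_upwards [hτ', hW] with t ht htW
    refine ht.trans_eq ?_
    simp only [pathSum, List.length_map]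
    refine Finset.sum_congr rfl fun j hj => ?_
    rw [← List.map_take, htW j hj])
  have := this.map (φ := List.map g) (S₀ := ∅) (𝒞' := branchFamily f c Q) (LastIn.map hg) (by
    rintro S ⟨t, ht, hS⟩
    refine ⟨t.map g, ht, ?_⟩
    rintro _ (⟨s, hs, rfl⟩ | h)
    · obtain ⟨h1, h2, h3⟩ := hS s hs
      exact ⟨h1.map g, by simpa using h2, h3⟩
    · exact h.elim)
  simpa using this

theorem spread_pure_label (U : Ultrafilter D) (a : Ordinal.{w}) (hW : ∀ d, W [(a, d)] = 1) :
    Spread (U : Filter D) (U.map fun d => [(a, d)]) W 1 := by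
  intro f M c τ Q hf hcτ hQ hτ
  have hτ' : ∀ᶠ d in U, τ < f [(a, d)] [(a, d)] := by
    have : ∀ᶠ d in U, τ < pathSum W f [(a, d)] := hτ
    filter_upwards [this] with d hd
    simpa [pathSum, hW] using hd
  have hQ' : ∀ᶠ d in U, [(a, d)] ∈ Q := hQ
  refine extendable_iff.2 ⟨?_, fun β hβ E hE => ?_⟩
  · obtain ⟨d, hd⟩ := hQ'.exists
    exact ⟨_, hd, by simp⟩
  · obtain rfl : β = 0 := by simpa using hβ
    obtain ⟨d, h1, h2, h3⟩ := (hτ'.and (hQ'.and hE)).exists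
    refine ⟨[(a, d)], ⟨[], (a, d), rfl, h3⟩, extendable_zero ⟨_, h2, ?_⟩⟩
    simpa using hcτ.trans h1

theorem multiSpread_zero : MultiSpread 𝒰 (pure [] : Ultrafilter _) W α 0 := by
  intro f M c τ Q m hf hcM hm hQ hτ
  have hτ0 : τ < 0 := by
    have : τ < pathSum W f [] := hτ
    simpa [pathSum] using this
  have hm0 : m = 0 := by
    by_contra h
    have : (0 : ℝ) ≤ m * (M - c) := mul_nonneg (Nat.cast_nonneg m) (sub_nonneg.2 hcM)
    push_cast at hm
    nlinarith
  subst hm0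
  have hQ' : [] ∈ Q := hQ
  simpa using extendable_zero (𝒰 := 𝒰) (𝒞 := branchFamily f c Q) (S := ∅) ⟨[], hQ', by simp⟩

/-- Since the second part is drawn after the first, $f$ on the first part is replaced by its limit
$f_1$ along `V'`. If the first average of $f_1$ is at most about $c$, all good blocks are found in
the rest. Otherwise the first block is good, it costs at most $M$, and one block fewer is needed
from the rest. -/
theorem MultiSpread.concat {n : ℕ} (hV : Spread 𝒰 V W α) (hV' : MultiSpread 𝒰 V' W' α n)
    (hW0 : ∀ s, 0 ≤ W s)
    (hW1 : ∀ᶠ t : List (Ordinal.{w} × D) in V,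
      ∑ j ∈ Finset.Ioc 0 t.length, W (t.take j) = 1)
    (hW : ∀ᶠ t : List (Ordinal.{w} × D) in V,
      ∀ j ∈ Finset.Ioc 0 t.length, W'' (t.take j) = W (t.take j))
    (hW' : ∀ᶠ t : List (Ordinal.{w} × D) in V, ∀ᶠ u : List (Ordinal.{w} × D) in V',
      ∀ j ∈ Finset.Ioc 0 u.length,      W'' (t ++ u.take j) = W' (u.take j)) :
    MultiSpread 𝒰 (concatUltra V V') W'' α (n + 1) := by
  intro f M c τ Q m hf hcM hm hQ hτ
  rcases m with _ | k
  · obtain ⟨t, ht⟩ := (concatUltra V V').nonempty_of_mem hQ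
    simpa using extendable_zero (𝒰 := 𝒰) (𝒞 := branchFamily f c Q) (S := ∅)
      ⟨t, ht, by simp⟩
  obtain ⟨ε, hε, hεm⟩ : ∃ ε > 0, (↑(k + 1) * M + ((n : ℝ) + 1 - ↑(k + 1)) * c) + 2 * ε < τ := by
    refine ⟨(τ - (↑(k + 1) * M + ((n : ℝ) + 1 - ↑(k + 1)) * c)) / 3, ?_, ?_⟩ <;>
      push_cast at hm ⊢ <;> linarith
  choose f₁ hf₁ hlim using fun s t =>
    exists_ultralimit V' (φ := fun u => f s (t ++ u)) (fun u => hf s (t ++ u))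
  -- the continuations of `t` on which the values of `f` on `t` exceed `c` if the limits do
  let R : List (Ordinal.{w} × D) → Set (List (Ordinal.{w} × D)) := fun t =>
    {u | t ++ u ∈ Q ∧ ∀ j ∈ Finset.Ioc 0 t.length, c < f₁ (t.take j) t →
      c < f (t.take j) (t ++ u)}
  have hR : ∀ᶠ t in V, R t ∈ V' := by
    have hQ' : ∀ᶠ t in V, ∀ᶠ u in V', t ++ u ∈ Q := hQ
    filter_upwards [hQ'] with t ht
    refine ht.and ((eventually_all_finset _).2 fun j hj => ?_)
    by_cases hc : c < f₁ (t.take j) t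
    · filter_upwards [(hlim (t.take j) t).eventually_const_lt hc] with u hu _ using hu
    · exact Eventually.of_forall fun u h => absurd h hc
  have hsplit : ∀ᶠ t in V, ∀ᶠ u in V',
      τ < ∑ j ∈ Finset.Ioc 0 t.length, W (t.take j) * f (t.take j) (t ++ u) +
        pathSum W' (fun s u => f (t ++ s) (t ++ u)) u := by
    have hτ' : ∀ᶠ t in V, ∀ᶠ u in V', τ < pathSum W'' f (t ++ u) := hτ
    filter_upwards [hτ', hW, hW'] with t h1 h2 h3
    filter_upwards [h1, h3] with u h1 h3
    refine h1.trans_eq ?_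
    rw [pathSum, sum_Ioc_length_append (fun s => W'' s * f s (t ++ u)), pathSum]
    congr 1
    · exact Finset.sum_congr rfl fun j hj => by rw [h2 j hj]
    · exact Finset.sum_congr rfl fun j hj => by rw [h3 j hj]
  have htend : ∀ t, Tendsto
      (fun u => ∑ j ∈ Finset.Ioc 0 t.length, W (t.take j) * f (t.take j) (t ++ u)) V'
      (𝓝 (pathSum W f₁ t)) := fun t =>
    tendsto_finsetSum _ fun j _ => (hlim _ _).const_mul _
  -- The nodes `S` already chosen on `t` by means of $f_1$ remain good for $f$ on every continuation
  -- in `R t`, so a game played above `t` can be appended to them.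
  have hmap : ∀ t, ∀ S ∈ branchFamily f₁ c {t}, ∀ β,
      Extendable 𝒰 (branchFamily (fun s u => f (t ++ s) (t ++ u)) c (R t)) β ∅ →
      Extendable 𝒰 (branchFamily f c Q) β S := by
    rintro t S ⟨t', ht', hS⟩ β hβ
    obtain rfl : t = t' := ht'.symm
    have := hβ.map (φ := fun s => t ++ s) (S₀ := S) (𝒞' := branchFamily f c Q)
      (LastIn.append t) (by
        rintro S' ⟨u, ⟨hu, hu'⟩, hS'⟩
        refine ⟨t ++ u, hu, ?_⟩
        rintro s (⟨s, hs, rfl⟩ | hs)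
        · obtain ⟨h1, h2, h3⟩ := hS' s hs
          exact ⟨(List.prefix_append_right_inj t).2 h1, by simp [h2], h3⟩
        · obtain ⟨h1, h2, h3⟩ := hS s hs
          have hst : t.take s.length = s := (List.prefix_iff_eq_take.1 h1).symm
          refine ⟨h1.trans (List.prefix_append t u), h2, ?_⟩
          have := hu' s.length (Finset.mem_Ioc.2 ⟨List.length_pos_iff.2 h2, h1.length_le⟩)
          rw [hst] at this
          exact this h3)
    simpa using this
  -- The ultrafilter decides whether the first block is almost surely bad or almost surely good.
  rcases V.em (fun t => pathSum W f₁ t ≤ c + ε / 2) with hle | hgt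
  · obtain ⟨t, hle, hR, hsplit⟩ := (hle.and (hR.and hsplit)).exists
    refine hmap t ∅ ⟨t, rfl, by simp⟩ _ ?_
    refine hV' _ M c (τ - c - ε) _ (k + 1) (fun s u => hf _ _) hcM ?_ hR ?_
    · push_cast at hεm ⊢; linarith
    · have := (htend t).eventually_lt_const (show pathSum W f₁ t < c + ε by linarith)
      filter_upwards [this, hsplit] with u h1 h2
      linarith
  · have hrest : ∀ᶠ t in V, Extendable 𝒰
        (branchFamily (fun s u => f (t ++ s) (t ++ u)) c (R t)) (α * k) ∅ := by
      filter_upwards [hR, hsplit, hW1] with t hR hsplit hW1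
      refine hV' _ M c (τ - M) _ k (fun s u => hf _ _) hcM ?_ hR ?_
      · push_cast at hεm ⊢; linarith
      · filter_upwards [hsplit] with u hu
        have : ∑ j ∈ Finset.Ioc 0 t.length, W (t.take j) * f (t.take j) (t ++ u) ≤ M := by
          calc _ ≤ ∑ j ∈ Finset.Ioc 0 t.length, W (t.take j) * M :=
                Finset.sum_le_sum fun j _ =>
                  mul_le_mul_of_nonneg_left (abs_le.1 (hf _ _)).2 (hW0 _)
            _ = M := by rw [← Finset.sum_mul, hW1, one_mul]
        linarith
    have hgt' : ∀ᶠ t in V, c + ε / 2 < pathSum W f₁ t := by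
      filter_upwards [hgt] with t ht using not_le.1 ht
    -- The set `Q` of this application consists of the `t` above which the remaining $\alpha k$
    -- moves are available.
    have h₁ := hV f₁ M c (c + ε / 2) _ hf₁ (by linarith) hrest hgt'
    have := h₁.add (𝒞' := branchFamily f c Q) (γ := α * k) (by
      rintro S ⟨t, ht, hS⟩
      exact hmap t S ⟨t, rfl, hS⟩ _ ht)
    rwa [Nat.cast_succ, mul_add_one]

/-- A random choice among ultrafilters that spread. -/
theorem Spread.bind {ι : Type*} {L : Ultrafilter ι} {V : ι → Ultrafilter (List (Ordinal.{w} × D))}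
    {β : ι → Ordinal.{w}} (hV : ∀ i, Spread 𝒰 (V i) W (β i))
    (hβ : ∀ γ < α, ∀ᶠ i in L, γ < β i) : Spread 𝒰 (L.bind V) W α := by
  intro f M c τ Q hf hcτ hQ hτ
  have h : ∀ᶠ i in L, Extendable 𝒰 (branchFamily f c Q) (β i) ∅ := by
    have hQ' : ∀ᶠ i in L, Q ∈ V i := hQ
    filter_upwards [eventually_ultraBind.1 hτ, hQ'] with i h1 h2
    exact hV i f M c τ Q hf hcτ h2 h1
  refine extendable_of_forall_lt h.exists.choose_spec.mem fun γ hγ => ?_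
  obtain ⟨i, hi, hi'⟩ := ((hβ γ hγ).and h).exists
  exact ⟨β i, hi, hi'⟩

/-- A random choice of the number of averages. -/
theorem MultiSpread.bind {L : Ultrafilter ℕ} (hL : (L : Filter ℕ) ≤ atTop)
    {V : ℕ → Ultrafilter (List (Ordinal.{w} × D))} {W' : ℕ → List (Ordinal.{w} × D) → ℝ}
    (hV : ∀ n, MultiSpread 𝒰 (V n) (W' n) α n)
    (hW : ∀ n : ℕ, ∀ᶠ t : List (Ordinal.{w} × D) in V n, ∀ j ∈ Finset.Ioc 0 t.length,
      W (t.take j) = (n : ℝ)⁻¹ * W' n (t.take j)) :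
    Spread 𝒰 (L.bind V) W (α * ω) := by
  intro f M c τ Q hf hcτ hQ hτ
  have key : ∀ m : ℕ, Extendable 𝒰 (branchFamily f c Q) (α * m) ∅ := by
    intro m
    have hQ' : ∀ᶠ i in L, Q ∈ V i := hQ
    -- With $M'=\max(M,c)$ this says $mM'+(n-m)c<n\tau$, the hypothesis of `MultiSpread` for $m$
    -- good blocks out of $n$.
    have hn : ∀ᶠ n : ℕ in L, (m : ℝ) * (max M c - c) / (τ - c) < n :=
      Eventually.filter_mono hL (tendsto_natCast_atTop_atTop.eventually_gt_atTop _)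
    obtain ⟨n, h1, h2, h3, h4⟩ := ((eventually_ultraBind.1 hτ).and
      (hQ'.and (hn.and (Eventually.filter_mono hL (eventually_gt_atTop 0))))).exists
    have hn0 : (0 : ℝ) < n := Nat.cast_pos.2 h4
    refine hV n f (max M c) c (n * τ) Q m (fun s t => (hf s t).trans (le_max_left _ _))
      (le_max_right _ _) ?_ h2 ?_
    · rw [div_lt_iff₀ (sub_pos.2 hcτ)] at h3
      linarith
    · filter_upwards [h1, hW n] with t ht htW
      have : pathSum W f t = (n : ℝ)⁻¹ * pathSum (W' n) f t := by
        rw [pathSum, pathSum, Finset.mul_sum]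
        exact Finset.sum_congr rfl fun j hj => by rw [htW j hj, mul_assoc]
      rw [this, lt_inv_mul_iff₀ hn0] at ht
      exact ht
  refine extendable_of_forall_lt (key 0).mem fun γ hγ => ?_
  obtain ⟨m, hm⟩ : ∃ m : ℕ, γ < α * m := by
    obtain ⟨m, hm, hm'⟩ := (Ordinal.lt_mul_iff_of_isSuccLimit Ordinal.isSuccLimit_omega0).1 hγ
    obtain ⟨m, rfl⟩ := Ordinal.lt_omega0.1 hm
    exact ⟨m, hm'⟩
  exact ⟨_, hm, key m⟩

end Spread

/-! ## The trees `Γ_ξ` and the weights -/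

section GammaLemmas

variable {ξ ζ : Ordinal.{w}} {n m : ℕ}

theorem gammaTree_zero : gammaTree (0 : Ordinal.{w}) = {[0]} := by
  rw [gammaTree, Ordinal.limitRecOn_zero]

theorem gammaTree_add_one : gammaTree (ξ + 1) = ⋃ n, gammaN ξ n := by
  rw [gammaTree, Ordinal.limitRecOn_add_one]; rfl

theorem mem_gammaTree_limit (hξ : Order.IsSuccLimit ξ) {t : List Ordinal.{w}} :
    t ∈ gammaTree ξ ↔ ∃ ζ < ξ, t ∈ shift (ω ^ ζ) '' gammaTree (ζ + 1) := by
  rw [gammaTree, Ordinal.limitRecOn_limit _ _ _ _ hξ]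
  simp only [Set.mem_iUnion, exists_prop]
  rfl

theorem weight_zero (t : List Ordinal.{w}) : weight 0 t = 1 := by
  rw [weight, Ordinal.limitRecOn_zero]

theorem weight_add_one (t : List Ordinal.{w}) : weight (ξ + 1) t =
    ((sInf {n : ℕ | t ∈ gammaN ξ n} : ℕ) : ℝ)⁻¹ * weight ξ (iota ξ t) := by
  rw [weight, Ordinal.limitRecOn_add_one]; rfl

open Classical in
theorem weight_limit (hξ : Order.IsSuccLimit ξ) (t : List Ordinal.{w}) : weight ξ t =
    if sInf {ζ : Ordinal.{w} | ζ < ξ ∧ t ∈ shift (ω ^ ζ) '' gammaTree (ζ + 1)} + 1 < ξ then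
      weight (sInf {ζ : Ordinal.{w} | ζ < ξ ∧ t ∈ shift (ω ^ ζ) '' gammaTree (ζ + 1)} + 1)
        (t.map fun a =>
          a - ω ^ sInf {ζ : Ordinal.{w} | ζ < ξ ∧ t ∈ shift (ω ^ ζ) '' gammaTree (ζ + 1)})
    else 0 := by
  rw [weight, Ordinal.limitRecOn_limit _ _ _ _ hξ]
  rfl

theorem weight_nonneg (ξ : Ordinal.{w}) (t : List Ordinal.{w}) : 0 ≤ weight ξ t := by
  induction ξ using Ordinal.limitRecOn generalizing t with
  | zero => simp [weight_zero]
  | add_one ξ IH =>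
    rw [weight_add_one]
    exact mul_nonneg (inv_nonneg.2 (Nat.cast_nonneg _)) (IH _)
  | limit ξ hξ IH =>
    rw [weight_limit hξ]
    split_ifs with h
    · exact IH _ h _
    · exact le_rfl

theorem shift_injective (ζ : Ordinal.{w}) : Function.Injective (shift ζ) :=
  List.map_injective_iff.2 fun _ _ h => add_left_cancel h

theorem shift_prefix_shift {s t : List Ordinal.{w}} : shift ζ s <+: shift ζ t ↔ s <+: t :=
  List.prefix_map_iff_of_injective fun _ _ h => add_left_cancel h

theorem properInit_shift {s t : List Ordinal.{w}} :
    ProperInit (shift ζ s) (shift ζ t) ↔ ProperInit s t := by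
  rw [ProperInit, ProperInit, shift_prefix_shift, (shift_injective ζ).ne_iff]

theorem maxSet_shift (G : Set (List Ordinal.{w})) :
    maxSet (shift ζ '' G) = shift ζ '' maxSet G := by
  ext t
  constructor
  · rintro ⟨⟨s, hs, rfl⟩, h⟩
    exact ⟨s, ⟨hs, fun r hr hsr => h _ ⟨r, hr, rfl⟩ (properInit_shift.2 hsr)⟩, rfl⟩
  · rintro ⟨s, ⟨hs, h⟩, rfl⟩
    refine ⟨⟨s, hs, rfl⟩, ?_⟩
    rintro _ ⟨r, hr, rfl⟩ hsr
    exact h r hr (properInit_shift.1 hsr)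

theorem prefix_append_iff_or {α : Type*} {s a b : List α} :
    s <+: a ++ b ↔ s <+: a ∨ ∃ r, r ≠ [] ∧ r <+: b ∧ s = a ++ r := by
  constructor
  · intro h
    rcases List.prefix_or_prefix_of_prefix h (List.prefix_append a b) with h' | ⟨r, rfl⟩
    · exact Or.inl h'
    · by_cases hr : r = []
      · subst hr; simp
      · exact Or.inr ⟨r, hr, (List.prefix_append_right_inj a).1 h, rfl⟩
  · rintro (h | ⟨r, -, h, rfl⟩)
    · exact h.trans (List.prefix_append a b)
    · exact (List.prefix_append_right_inj a).2 h

/-- All non-empty initial segments of `t` are in `G`, and no proper extension is. -/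
def IsFullBranch {Λ : Type*} (G : Set (List Λ)) (t : List Λ) : Prop :=
  (∀ s, s ≠ [] → s <+: t → s ∈ G) ∧ ∀ s ∈ G, ¬ ProperInit t s

theorem IsFullBranch.mem_maxSet {Λ : Type*} {G : Set (List Λ)} {t : List Λ}
    (h : IsFullBranch G t) (ht : t ≠ []) : t ∈ maxSet G := ⟨h.1 t ht List.prefix_rfl, h.2⟩

theorem mem_gammaN_succ {r : List Ordinal.{w}} : r ∈ gammaN ξ (n + 1) ↔
    (∃ t ∈ gammaTree ξ, r = shift (ω ^ ξ * n) t) ∨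
      ∃ t ∈ maxSet (gammaTree ξ), ∃ u ∈ gammaN ξ n, r = shift (ω ^ ξ * n) t ++ u := by
  rw [gammaN, gammaAux, maxSet_shift]
  refine or_congr (exists_congr fun t => and_congr_right fun _ => eq_comm) ?_
  simp only [Set.mem_ofPred_eq, Set.mem_image, exists_exists_and_eq_and]
  rfl

theorem notMem_gammaN_zero {r : List Ordinal.{w}} : r ∉ gammaN ξ 0 := Set.notMem_empty r

theorem omega0_opow_ne_zero (ξ : Ordinal.{w}) : ω ^ ξ ≠ 0 := (Ordinal.opow_pos ξ Ordinal.omega0_pos).ne'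

theorem add_lt_mul_succ {c a b : Ordinal.{w}} (h : a < b) : b * c + a < b * (c + 1) := by
  rw [mul_add_one]; exact (add_lt_add_iff_left _).2 h

theorem mem_shift_bounds {c : Ordinal.{w}} {t : List Ordinal.{w}} (ht : ∀ a ∈ t, a < ω ^ ξ) :
    ∀ a ∈ shift (ω ^ ξ * c) t, ω ^ ξ * c ≤ a ∧ a < ω ^ ξ * (c + 1) := by
  intro a ha
  obtain ⟨b, hb, rfl⟩ := List.mem_map.1 ha
  exact ⟨le_self_add, add_lt_mul_succ (ht b hb)⟩

/-- The blocks run downwards, from $\omega^\xi(n-1)+\cdot$ to $\omega^\xi 0+\cdot$. Thus the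
quotient of the first entry by $\omega^\xi$ is exactly $n-1$, and the first entry alone determines
$n$. -/
theorem gammaN_bounds (hG : ∀ t ∈ gammaTree ξ, t ≠ [] ∧ ∀ a ∈ t, a < ω ^ ξ)
    {t : List Ordinal.{w}} (ht : t ∈ gammaN ξ n) :
    (∀ a ∈ t, a < ω ^ ξ * n) ∧ ∃ a l, t = a :: l ∧ ω ^ ξ * n ≤ ω ^ ξ * (a / ω ^ ξ + 1) := by
  induction n generalizing t with
  | zero => exact absurd ht notMem_gammaN_zero
  | succ n IH =>
    have key : ∀ s ∈ gammaTree ξ, (∀ a ∈ shift (ω ^ ξ * n) s, a < ω ^ ξ * (n + 1 : ℕ)) ∧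
        ∃ a l, shift (ω ^ ξ * n) s = a :: l ∧
          ω ^ ξ * (n + 1 : ℕ) ≤ ω ^ ξ * (a / ω ^ ξ + 1) := by
      intro s hs
      refine ⟨fun a ha => ?_, ?_⟩
      · have := (mem_shift_bounds (hG s hs).2 a ha).2
        push_cast; exact this
      · obtain ⟨b, l, rfl⟩ := List.exists_cons_of_ne_nil (hG s hs).1
        refine ⟨ω ^ ξ * n + b, shift (ω ^ ξ * n) l, rfl, ?_⟩
        rw [Ordinal.mul_add_div _ (omega0_opow_ne_zero ξ), Ordinal.div_eq_zero_of_lt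
          ((hG _ hs).2 b (by simp))]
        push_cast; simp
    rcases mem_gammaN_succ.1 ht with ⟨s, hs, rfl⟩ | ⟨s, hs, u, hu, rfl⟩
    · exact key s hs
    · obtain ⟨h1, a, l, h2, h3⟩ := key s hs.1
      refine ⟨fun b hb => ?_, a, l ++ u, by rw [h2]; rfl, h3⟩
      rcases List.mem_append.1 hb with hb | hb
      · exact h1 b hb
      · exact ((IH hu).1 b hb).trans_le (mul_le_mul_right (by exact_mod_cast n.le_succ) _)

theorem gammaTree_bounds (ξ : Ordinal.{w}) :
    ∀ t ∈ gammaTree ξ, t ≠ [] ∧ ∀ a ∈ t, a < ω ^ ξ := by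
  induction ξ using Ordinal.limitRecOn with
  | zero => simp [gammaTree_zero]
  | add_one ξ IH =>
    intro t ht
    rw [gammaTree_add_one] at ht
    obtain ⟨n, hn⟩ := Set.mem_iUnion.1 ht
    obtain ⟨h1, a, l, rfl, -⟩ := gammaN_bounds IH hn
    refine ⟨by simp, fun b hb => (h1 b hb).trans ?_⟩
    exact Ordinal.opow_mul_lt_opow (Ordinal.natCast_lt_omega0 n) (lt_add_one ξ)
  | limit ξ hξ IH =>
    intro t ht
    obtain ⟨ζ, hζ, s, hs, rfl⟩ := (mem_gammaTree_limit hξ).1 ht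
    obtain ⟨h1, h2⟩ := IH _ (hξ.add_one_lt hζ) s hs
    refine ⟨by simpa [shift] using h1, fun a ha => ?_⟩
    obtain ⟨b, hb, rfl⟩ := List.mem_map.1 ha
    have hlt : ω ^ ζ < ω ^ ξ := (Ordinal.opow_lt_opow_iff_right Ordinal.one_lt_omega0).2 hζ
    refine Ordinal.isPrincipal_add_omega0_opow ξ hlt ((h2 b hb).trans ?_)
    exact (Ordinal.opow_lt_opow_iff_right Ordinal.one_lt_omega0).2 (hξ.add_one_lt hζ)

theorem gammaN_unique {t s : List Ordinal.{w}} {a : Ordinal.{w}} (ht : a :: t ∈ gammaN ξ n)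
    (hs : a :: s ∈ gammaN ξ m) : n = m := by
  have key : ∀ {n m : ℕ} {t s : List Ordinal.{w}}, a :: t ∈ gammaN ξ n → a :: s ∈ gammaN ξ m →
      n ≤ m := by
    intro n m t s ht hs
    obtain ⟨-, b, l, h, hb⟩ := gammaN_bounds (gammaTree_bounds ξ) ht
    obtain rfl : a = b := (List.cons.inj h).1
    have ha := (gammaN_bounds (gammaTree_bounds ξ) hs).1 a (by simp)
    have h1 : a / ω ^ ξ < m := (Ordinal.lt_mul_iff_div_lt (omega0_opow_ne_zero ξ)).1 ha
    have h2 : (n : Ordinal.{w}) ≤ a / ω ^ ξ + 1 :=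
      le_of_mul_le_mul_left hb (Ordinal.opow_pos ξ Ordinal.omega0_pos)
    exact_mod_cast h2.trans (Order.add_one_le_of_lt h1)
  exact le_antisymm (key ht hs) (key hs ht)

theorem weight_add_one_of_mem {t : List Ordinal.{w}} (ht : t ∈ gammaN ξ n) :
    weight (ξ + 1) t = (n : ℝ)⁻¹ * weight ξ (iota ξ t) := by
  obtain ⟨-, a, l, rfl, -⟩ := gammaN_bounds (gammaTree_bounds ξ) ht
  have : {m : ℕ | a :: l ∈ gammaN ξ m} = {n} :=
    Set.eq_singleton_iff_unique_mem.2 ⟨ht, fun m hm => gammaN_unique hm ht⟩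
  rw [weight_add_one, this, csInf_singleton]

/-- The first entry lies in $[\omega^\zeta,\omega^{\zeta+1})$, and these intervals are disjoint for
different $\zeta$. -/
theorem shift_gammaTree_unique {ζ' : Ordinal.{w}} {t s : List Ordinal.{w}} {a : Ordinal.{w}}
    (ht : a :: t ∈ shift (ω ^ ζ) '' gammaTree (ζ + 1))
    (hs : a :: s ∈ shift (ω ^ ζ') '' gammaTree (ζ' + 1)) : ζ = ζ' := by
  have key : ∀ {ζ : Ordinal.{w}} {t : List Ordinal.{w}},
      a :: t ∈ shift (ω ^ ζ) '' gammaTree (ζ + 1) → ω ^ ζ ≤ a ∧ a < ω ^ (ζ + 1) := by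
    rintro ζ t ⟨r, hr, h⟩
    obtain ⟨b, l, rfl⟩ := List.exists_cons_of_ne_nil (gammaTree_bounds _ r hr).1
    obtain rfl : ω ^ ζ + b = a := (List.cons.inj h).1
    refine ⟨le_self_add, Ordinal.isPrincipal_add_omega0_opow _ ?_
      ((gammaTree_bounds _ _ hr).2 b (by simp))⟩
    exact (Ordinal.opow_lt_opow_iff_right Ordinal.one_lt_omega0).2 (lt_add_one ζ)
  have h1 := (key ht).1.trans_lt (key hs).2
  have h2 := (key hs).1.trans_lt (key ht).2
  rw [Ordinal.opow_lt_opow_iff_right Ordinal.one_lt_omega0, Order.lt_add_one_iff] at h1 h2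
  exact le_antisymm h1 h2

theorem weight_limit_shift (hξ : Order.IsSuccLimit ξ) (hζ : ζ < ξ) {t : List Ordinal.{w}}
    (ht : t ∈ gammaTree (ζ + 1)) : weight ξ (shift (ω ^ ζ) t) = weight (ζ + 1) t := by
  have : {η : Ordinal.{w} | η < ξ ∧ shift (ω ^ ζ) t ∈ shift (ω ^ η) '' gammaTree (η + 1)} =
      {ζ} := by
    refine Set.eq_singleton_iff_unique_mem.2 ⟨⟨hζ, t, ht, rfl⟩, fun η hη => ?_⟩
    have ht' : shift (ω ^ ζ) t ∈ shift (ω ^ ζ) '' gammaTree (ζ + 1) := ⟨t, ht, rfl⟩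
    obtain ⟨b, l, rfl⟩ := List.exists_cons_of_ne_nil (gammaTree_bounds _ t ht).1
    exact shift_gammaTree_unique hη.2 ht'
  rw [weight_limit hξ, this, csInf_singleton, if_pos (hξ.add_one_lt hζ), shift, List.map_map]
  congr 1
  conv_rhs => rw [← List.map_id t]
  refine List.map_congr_left fun a _ => ?_
  simp

theorem iota_append {s t : List Ordinal.{w}} (ht : t ≠ [])
    (h : ∀ a ∈ s, ∀ b ∈ t, a / ω ^ ξ ≠ b / ω ^ ξ) : iota ξ (s ++ t) = iota ξ t := by
  rw [iota, iota, List.getLast?_append_of_ne_nil _ ht, List.filter_append]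
  have : s.filter (fun a => a / ω ^ ξ = (t.getLast?.getD 0) / ω ^ ξ) = [] := by
    rw [List.filter_eq_nil_iff]
    intro a ha
    rw [decide_eq_true_eq, List.getLast?_eq_getLast_of_ne_nil ht]
    exact h a ha _ (List.getLast_mem ht)
  rw [this, List.nil_append]

theorem iota_shift (c : Ordinal.{w}) {t : List Ordinal.{w}} (h : ∀ a ∈ t, a < ω ^ ξ) :
    iota ξ (shift (ω ^ ξ * c) t) = t := by
  have hdiv : ∀ a ∈ shift (ω ^ ξ * c) t, a / ω ^ ξ = c := by
    intro a ha
    obtain ⟨b, hb, rfl⟩ := List.mem_map.1 ha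
    rw [Ordinal.mul_add_div _ (omega0_opow_ne_zero ξ), Ordinal.div_eq_zero_of_lt (h b hb), add_zero]
  by_cases ht : t = []
  · subst ht; simp [iota, shift]
  have ht' : shift (ω ^ ξ * c) t ≠ [] := by simpa [shift] using ht
  rw [iota, List.filter_eq_self.2, shift, List.map_map]
  · conv_rhs => rw [← List.map_id t]
    refine List.map_congr_left fun a ha => ?_
    simp only [Function.comp, id, Ordinal.mul_add_mod_self]
    exact Ordinal.mod_eq_of_lt (h a ha)
  · intro a ha
    rw [decide_eq_true_eq, List.getLast?_eq_getLast_of_ne_nil ht', Option.getD_some, hdiv a ha,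
      hdiv _ (List.getLast_mem ht')]

theorem isFullBranch_gammaN_zero : IsFullBranch (gammaN ξ 0) [] :=
  ⟨fun _ hs h => absurd (List.prefix_nil.1 h) hs, fun _ hs => absurd hs notMem_gammaN_zero⟩

theorem IsFullBranch.gammaN_succ {t u : List Ordinal.{w}} (ht : IsFullBranch (gammaTree ξ) t)
    (ht0 : t ≠ []) (hu : IsFullBranch (gammaN ξ n) u) :
    IsFullBranch (gammaN ξ (n + 1)) (shift (ω ^ ξ * n) t ++ u) := by
  have htm := ht.mem_maxSet ht0
  refine ⟨fun r hr h => ?_, fun r hr h => ?_⟩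
  · rcases prefix_append_iff_or.1 h with h' | ⟨v, hv, h', rfl⟩
    · obtain ⟨s, hs, rfl⟩ := List.prefix_map_iff.1 h'
      refine mem_gammaN_succ.2 (Or.inl ⟨s, ht.1 s ?_ hs, rfl⟩)
      rintro rfl; exact hr rfl
    · exact mem_gammaN_succ.2 (Or.inr ⟨t, htm, v, hu.1 v hv h', rfl⟩)
  · rcases mem_gammaN_succ.1 hr with ⟨s, hs, rfl⟩ | ⟨s, hs, v, hv, rfl⟩
    · have h1 : ProperInit t s := by
        refine ⟨shift_prefix_shift.1 ((List.prefix_append _ u).trans h.1), ?_⟩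
        rintro rfl
        exact h.2 (h.1.eq_of_length_le (by simp))
      exact ht.2 s hs h1
    · have hst : s = t := by
        rcases List.prefix_or_prefix_of_prefix ((List.prefix_append _ u).trans h.1)
          (List.prefix_append (shift (ω ^ ξ * n) s) v) with h' | h' <;>
          rw [shift_prefix_shift] at h' <;> by_contra hne
        · exact ht.2 s hs.1 ⟨h', Ne.symm hne⟩
        · exact hs.2 t htm.1 ⟨h', hne⟩
      subst hst
      refine hu.2 v hv ⟨(List.prefix_append_right_inj _).1 h.1, ?_⟩
      rintro rfl
      exact h.2 rfl

/-- An extension of `t` in the union has the same first entry, so it belongs to the same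
$\Gamma_{\xi,n}$, where `t` is already maximal. -/
theorem IsFullBranch.gammaTree_add_one {t : List Ordinal.{w}} (ht : IsFullBranch (gammaN ξ n) t)
    (ht0 : t ≠ []) : IsFullBranch (gammaTree (ξ + 1)) t := by
  rw [XiAUS.gammaTree_add_one]
  refine ⟨fun s hs h => Set.mem_iUnion.2 ⟨n, ht.1 s hs h⟩, fun s hs h => ?_⟩
  obtain ⟨m, hm⟩ := Set.mem_iUnion.1 hs
  have htn := ht.1 t ht0 List.prefix_rfl
  obtain ⟨a, l, rfl⟩ := List.exists_cons_of_ne_nil ht0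
  obtain ⟨r, rfl⟩ := h.1
  obtain rfl := gammaN_unique htn hm
  exact ht.2 _ hm h

theorem IsFullBranch.gammaTree_limit (hξ : Order.IsSuccLimit ξ) (hζ : ζ < ξ)
    {t : List Ordinal.{w}} (ht : IsFullBranch (gammaTree (ζ + 1)) t) (ht0 : t ≠ []) :
    IsFullBranch (gammaTree ξ) (shift (ω ^ ζ) t) := by
  refine ⟨fun s hs h => ?_, fun s hs h => ?_⟩
  · obtain ⟨s, h', rfl⟩ := List.prefix_map_iff.1 h
    refine (mem_gammaTree_limit hξ).2 ⟨ζ, hζ, s, ht.1 s ?_ h', rfl⟩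
    rintro rfl; exact hs rfl
  · obtain ⟨η, hη, hs'⟩ := (mem_gammaTree_limit hξ).1 hs
    have htn : shift (ω ^ ζ) t ∈ shift (ω ^ ζ) '' gammaTree (ζ + 1) :=
      ⟨t, ht.1 t ht0 List.prefix_rfl, rfl⟩
    obtain rfl : ζ = η := by
      obtain ⟨a, l, rfl⟩ := List.exists_cons_of_ne_nil ht0
      obtain ⟨r, rfl⟩ := h.1
      exact shift_gammaTree_unique htn hs'
    obtain ⟨r, hr, rfl⟩ := hs'
    exact ht.2 r hr (properInit_shift.1 h)

end GammaLemmas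

/-! ## Spreading ultrafilters on the branches of `Γ_ξ` -/

section Existence

variable {D : Type u}

/-- Shift the ordinals of a sequence of pairs. -/
def shiftFst (ζ : Ordinal.{w}) (a : Ordinal.{w} × D) : Ordinal.{w} × D := (ζ + a.1, a.2)

theorem map_fst_map_shiftFst (ζ : Ordinal.{w}) (t : List (Ordinal.{w} × D)) :
    (t.map (shiftFst ζ)).map Prod.fst = shift ζ (t.map Prod.fst) := by
  rw [shift, List.map_map, List.map_map]; rfl

theorem map_fst_take_mem {G : Set (List Ordinal.{w})} {t : List (Ordinal.{w} × D)}
    (h : IsFullBranch G (t.map Prod.fst)) {j : ℕ} (hj : j ∈ Finset.Ioc 0 t.length) :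
    (t.take j).map Prod.fst ∈ G :=
  h.1 _ (by simpa only [ne_eq, List.map_eq_nil_iff] using take_ne_nil hj)
    ((List.take_prefix j t).map Prod.fst)

/-- An ultrafilter of branches of `Γ_ξ D` along which averages for `ℙ_ξ` spread. -/
structure IsSpecial (𝒰 : Filter D) (ξ : Ordinal.{w})
    (V : Ultrafilter (List (Ordinal.{w} × D))) : Prop where
  full : ∀ᶠ t : List (Ordinal.{w} × D) in V, IsFullBranch (gammaTree ξ) (t.map Prod.fst) ∧ t ≠ []
  sum_eq : ∀ᶠ t : List (Ordinal.{w} × D) in V,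
    ∑ j ∈ Finset.Ioc 0 t.length, weight ξ ((t.take j).map Prod.fst) = 1
  spread : Spread 𝒰 V (fun s => weight ξ (s.map Prod.fst)) (ω ^ ξ)

/-- The weight in the last block. -/
def blockWeight (ξ : Ordinal.{w}) (s : List (Ordinal.{w} × D)) : ℝ :=
  weight ξ (iota ξ (s.map Prod.fst))

theorem blockWeight_shift {ξ : Ordinal.{w}} (c : Ordinal.{w}) {t : List (Ordinal.{w} × D)}
    (h : IsFullBranch (gammaTree ξ) (t.map Prod.fst)) {j : ℕ} (hj : j ∈ Finset.Ioc 0 t.length) :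
    blockWeight ξ ((t.take j).map (shiftFst (ω ^ ξ * c))) = weight ξ ((t.take j).map Prod.fst) := by
  rw [blockWeight, map_fst_map_shiftFst, iota_shift]
  exact (gammaTree_bounds ξ _ (map_fst_take_mem h hj)).2

/-- A fresh copy, shifted by $\omega^\xi n$, is put in front of the $n$ blocks already built, as in
the recursion for $\Gamma_{\xi,n+1}$. Quotients by $\omega^\xi$ separate the blocks, so `iota` sees
only the last one and each block has total weight $1$. -/
theorem exists_multiSpread {𝒰 : Filter D} {ξ : Ordinal.{w}}
    {V : Ultrafilter (List (Ordinal.{w} × D))} (hV : IsSpecial 𝒰 ξ V) (n : ℕ) :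
    ∃ V' : Ultrafilter (List (Ordinal.{w} × D)),
      (∀ᶠ t : List (Ordinal.{w} × D) in V', IsFullBranch (gammaN ξ n) (t.map Prod.fst)) ∧
      (∀ᶠ t : List (Ordinal.{w} × D) in V',
        ∑ j ∈ Finset.Ioc 0 t.length, blockWeight ξ (t.take j) = n) ∧
      MultiSpread 𝒰 V' (blockWeight ξ) (ω ^ ξ) n := by
  induction n with
  | zero =>
    refine ⟨pure [], ?_, ?_, multiSpread_zero⟩
    · exact (isFullBranch_gammaN_zero : IsFullBranch (gammaN ξ 0) ([].map Prod.fst))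
    · change ∑ j ∈ Finset.Ioc 0 ([] : List (Ordinal.{w} × D)).length, _ = _
      simp
  | succ n IH =>
    obtain ⟨V', h1, h2, h3⟩ := IH
    have hfull : ∀ᶠ t : List (Ordinal.{w} × D) in V.map (List.map (shiftFst (ω ^ ξ * n))),
        ∃ s : List (Ordinal.{w} × D), t = s.map (shiftFst (ω ^ ξ * n)) ∧
          IsFullBranch (gammaTree ξ) (s.map Prod.fst) ∧ s ≠ [] ∧
          ∑ j ∈ Finset.Ioc 0 s.length, weight ξ ((s.take j).map Prod.fst) = 1 := by
      have : ∀ᶠ r : List (Ordinal.{w} × D) in V, ∃ s : List (Ordinal.{w} × D),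
          List.map (shiftFst (ω ^ ξ * n)) r = s.map (shiftFst (ω ^ ξ * n)) ∧
          IsFullBranch (gammaTree ξ) (s.map Prod.fst) ∧ s ≠ [] ∧
          ∑ j ∈ Finset.Ioc 0 s.length, weight ξ ((s.take j).map Prod.fst) = 1 := by
        filter_upwards [hV.full, hV.sum_eq] with s hs hs'
        exact ⟨s, rfl, hs.1, hs.2, hs'⟩
      exact this
    have hsum : ∀ᶠ t : List (Ordinal.{w} × D) in V.map (List.map (shiftFst (ω ^ ξ * n))),
        ∑ j ∈ Finset.Ioc 0 t.length, blockWeight ξ (t.take j) = 1 := by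
      filter_upwards [hfull] with t ht
      obtain ⟨s, rfl, hs1, -, hs2⟩ := ht
      rw [List.length_map, ← hs2]
      refine Finset.sum_congr rfl fun j hj => ?_
      rw [← List.map_take, blockWeight_shift _ hs1 hj]
    have happ : ∀ᶠ t : List (Ordinal.{w} × D) in V.map (List.map (shiftFst (ω ^ ξ * n))),
        ∀ᶠ u : List (Ordinal.{w} × D) in V', ∀ j ∈ Finset.Ioc 0 u.length,
          blockWeight ξ (t ++ u.take j) = blockWeight ξ (u.take j) := by
      filter_upwards [hfull] with t ht
      obtain ⟨s, rfl, hs1, hs0, -⟩ := ht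
      filter_upwards [h1] with u hu j hj
      rw [blockWeight, blockWeight, List.map_append, map_fst_map_shiftFst, iota_append]
      · simpa only [ne_eq, List.map_eq_nil_iff] using take_ne_nil hj
      · intro a ha b hb
        have hs := gammaTree_bounds ξ _ (hs1.1 _ (by simpa using hs0) List.prefix_rfl)
        have ha' := (mem_shift_bounds hs.2 a ha).1
        have hb' := (gammaN_bounds (gammaTree_bounds ξ) (map_fst_take_mem hu hj)).1 b hb
        have ha'' : (n : Ordinal.{w}) ≤ a / ω ^ ξ := (Ordinal.mul_le_iff_le_div (omega0_opow_ne_zero ξ)).1 ha'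
        have hb'' : b / ω ^ ξ < n := (Ordinal.lt_mul_iff_div_lt (omega0_opow_ne_zero ξ)).1 hb'
        exact (hb''.trans_le ha'').ne'
    refine ⟨concatUltra (V.map (List.map (shiftFst (ω ^ ξ * n)))) V', ?_, ?_, ?_⟩
    · rw [eventually_concatUltra]
      filter_upwards [hfull] with t ht
      obtain ⟨s, rfl, hs1, hs0, -⟩ := ht
      filter_upwards [h1] with u hu
      rw [List.map_append, map_fst_map_shiftFst]
      exact hs1.gammaN_succ (by simpa using hs0) hu
    · rw [eventually_concatUltra]
      filter_upwards [hsum, happ] with t ht ht'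
      filter_upwards [h2, ht'] with u hu hu'
      rw [sum_Ioc_length_append, ht, Finset.sum_congr rfl hu', hu]
      push_cast; ring
    · refine MultiSpread.concat (W := blockWeight ξ) (hV.spread.map (fun a => rfl) ?_) h3
        (fun s => weight_nonneg _ _) hsum (Eventually.of_forall fun t j hj => rfl) happ
      filter_upwards [hV.full] with t ht j hj
      exact blockWeight_shift _ ht.1 hj

/-- Successor: $n$ is drawn from a free ultrafilter on $\mathbb N$, followed by $n$ independent
blocks. Limit: $\zeta<\xi$ is drawn from an ultrafilter finer than the tails, followed by a shifted
branch of $\Gamma_{\zeta+1}$; the ranks $\omega^{\zeta+1}$ then exceed every $\gamma<\omega^\xi$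
almost surely. -/
theorem exists_isSpecial (𝒰 : Ultrafilter D) (ξ : Ordinal.{w}) :
    ∃ V, IsSpecial (𝒰 : Filter D) ξ V := by
  induction ξ using Ordinal.limitRecOn with
  | zero =>
    refine ⟨𝒰.map fun d => [(0, d)], ?_, ?_, ?_⟩
    · have : ∀ᶠ d : D in 𝒰, IsFullBranch (gammaTree (0 : Ordinal.{w}))
          ([((0 : Ordinal.{w}), d)].map Prod.fst) ∧ [((0 : Ordinal.{w}), d)] ≠ [] := by
        refine Eventually.of_forall fun d => ⟨⟨fun s hs h => ?_, fun s hs h => ?_⟩, by simp⟩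
        · rw [gammaTree_zero]
          simp only [List.map_cons, List.map_nil] at h
          rcases List.prefix_cons_iff.1 h with rfl | ⟨r, rfl, hr⟩
          · exact absurd rfl hs
          · rw [List.prefix_nil.1 hr]; rfl
        · rw [gammaTree_zero] at hs
          exact h.2 (by rw [Set.mem_singleton_iff.1 hs]; rfl)
      exact this
    · have : ∀ᶠ d : D in 𝒰, ∑ j ∈ Finset.Ioc 0 [((0 : Ordinal.{w}), d)].length,
          weight 0 (([((0 : Ordinal.{w}), d)].take j).map Prod.fst) = 1 :=
        Eventually.of_forall fun d => by simp [weight_zero]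
      exact this
    · rw [Ordinal.opow_zero]
      exact spread_pure_label 𝒰 0 fun d => weight_zero _
  | add_one ξ IH =>
    obtain ⟨V, hV⟩ := IH
    choose V' h1 h2 h3 using exists_multiSpread hV
    have hW : ∀ n : ℕ, ∀ᶠ t : List (Ordinal.{w} × D) in V' n, ∀ j ∈ Finset.Ioc 0 t.length,
        weight (ξ + 1) ((t.take j).map Prod.fst) = (n : ℝ)⁻¹ * blockWeight ξ (t.take j) := by
      intro n
      filter_upwards [h1 n] with t ht j hj
      exact weight_add_one_of_mem (map_fst_take_mem ht hj)
    have hL : ((hyperfilter ℕ : Ultrafilter ℕ) : Filter ℕ) ≤ atTop := Nat.hyperfilter_le_atTop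
    -- The value $n=0$ must be excluded: it gives the empty sequence, with total weight $0$.
    have hpos : ∀ᶠ n : ℕ in hyperfilter ℕ, 0 < n :=
      Eventually.filter_mono hL (eventually_gt_atTop 0)
    refine ⟨(hyperfilter ℕ).bind V', ?_, ?_, ?_⟩
    · rw [eventually_ultraBind]
      filter_upwards [hpos] with n hn
      filter_upwards [h1 n, h2 n] with t ht ht'
      have ht0 : t ≠ [] := by
        rintro rfl
        have : (n : ℝ) = 0 := by rw [← ht']; simp
        exact hn.ne' (by exact_mod_cast this)
      exact ⟨ht.gammaTree_add_one (by simpa using ht0), ht0⟩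
    · rw [eventually_ultraBind]
      filter_upwards [hpos] with n hn
      filter_upwards [h2 n, hW n] with t ht ht'
      rw [Finset.sum_congr rfl ht', ← Finset.mul_sum, ht]
      exact inv_mul_cancel₀ (by exact_mod_cast hn.ne')
    · rw [Ordinal.opow_add_one]
      exact MultiSpread.bind hL (W' := fun _ => blockWeight ξ) h3 hW
  | limit ξ hξ IH =>
    have hne : Nonempty (Set.Iio ξ) := ⟨⟨0, hξ.bot_lt⟩⟩
    choose V hV using fun ζ : Set.Iio ξ => IH (ζ.1 + 1) (hξ.add_one_lt ζ.2)
    have hW : ∀ ζ : Set.Iio ξ, ∀ᶠ t : List (Ordinal.{w} × D) in V ζ,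
        ∀ j ∈ Finset.Ioc 0 t.length,
          weight ξ (((t.take j).map (shiftFst (ω ^ ζ.1))).map Prod.fst) =
            weight (ζ.1 + 1) ((t.take j).map Prod.fst) := by
      intro ζ
      filter_upwards [(hV ζ).full] with t ht j hj
      rw [map_fst_map_shiftFst, weight_limit_shift hξ ζ.2 (map_fst_take_mem ht.1 hj)]
    refine ⟨(Ultrafilter.of (atTop : Filter (Set.Iio ξ))).bind
      fun ζ => (V ζ).map (List.map (shiftFst (ω ^ ζ.1))), ?_, ?_, ?_⟩
    · rw [eventually_ultraBind]
      refine Eventually.of_forall fun ζ => ?_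
      have : ∀ᶠ t : List (Ordinal.{w} × D) in V ζ, IsFullBranch (gammaTree ξ)
          ((t.map (shiftFst (ω ^ ζ.1))).map Prod.fst) ∧ t.map (shiftFst (ω ^ ζ.1)) ≠ [] := by
        filter_upwards [(hV ζ).full] with t ht
        rw [map_fst_map_shiftFst]
        exact ⟨ht.1.gammaTree_limit hξ ζ.2 (by simpa using ht.2), by simpa using ht.2⟩
      exact this
    · rw [eventually_ultraBind]
      refine Eventually.of_forall fun ζ => ?_
      have : ∀ᶠ t : List (Ordinal.{w} × D) in V ζ,
          ∑ j ∈ Finset.Ioc 0 (t.map (shiftFst (ω ^ ζ.1))).length,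
            weight ξ (((t.map (shiftFst (ω ^ ζ.1))).take j).map Prod.fst) = 1 := by
        filter_upwards [(hV ζ).sum_eq, hW ζ] with t ht ht'
        rw [List.length_map, ← ht]
        refine Finset.sum_congr rfl fun j hj => ?_
        rw [← List.map_take, ht' j hj]
      exact this
    · refine Spread.bind (β := fun ζ => ω ^ (ζ.1 + 1))
        (fun ζ => (hV ζ).spread.map (fun a => rfl) (hW ζ)) fun γ hγ => ?_
      obtain ⟨η, hη, hγη⟩ := (Ordinal.lt_opow_of_isSuccLimit Ordinal.omega0_ne_zero hξ).1 hγ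
      refine Eventually.filter_mono (Ultrafilter.of_le atTop) ?_
      filter_upwards [eventually_ge_atTop (⟨η, hη⟩ : Set.Iio ξ)] with ζ hζ
      refine hγη.trans_le (Ordinal.opow_le_opow_right Ordinal.omega0_pos ?_)
      exact (show η ≤ ζ.1 from hζ).trans (le_add_of_nonneg_right zero_le)

end Existence

/-! ## Trees of decreasing sequences of ordinals -/

section DecreasingTree

/-- A member of rank $r$ has proper extensions of exactly the ranks below $r$, so the $\zeta$-th
derivation removes precisely the ranks below $\zeta$. -/
theorem derivedTree_eq_of_rank {Λ : Type u} {C : Set (List Λ)} (r : List Λ → Ordinal.{w})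
    (hlt : ∀ b ∈ C, ∀ c ∈ C, ProperInit b c → r c < r b)
    (hex : ∀ b ∈ C, ∀ ζ < r b, ∃ c ∈ C, ProperInit b c ∧ r c = ζ) (ζ : Ordinal.{w}) :
    derivedTree C ζ = {b ∈ C | ζ ≤ r b} := by
  induction ζ using Ordinal.limitRecOn with
  | zero => rw [derivedTree, Ordinal.limitRecOn_zero]; simp
  | add_one ζ IH =>
    have : derivedTree C (ζ + 1) = derivedTree C ζ \ maxSet (derivedTree C ζ) := by
      rw [derivedTree, Ordinal.limitRecOn_add_one]; rfl
    rw [this, IH]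
    ext b
    simp only [Set.mem_sdiff, Set.mem_ofPred_eq, maxSet, not_and, not_forall, not_not]
    constructor
    · rintro ⟨⟨hb, hζ⟩, h⟩
      obtain ⟨c, ⟨hc, hζc⟩, hbc⟩ := h ⟨hb, hζ⟩
      exact ⟨hb, Order.add_one_le_of_lt (hζc.trans_lt (hlt b hb c hc hbc))⟩
    · rintro ⟨hb, hζ⟩
      have hζ' : ζ < r b := Order.add_one_le_iff.1 hζ
      obtain ⟨c, hc, hbc, rfl⟩ := hex b hb ζ hζ'
      exact ⟨⟨hb, hζ'.le⟩, fun _ => ⟨c, ⟨hc, le_rfl⟩, hbc⟩⟩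
  | limit ζ hζ IH =>
    have : derivedTree C ζ = ⋂ η, ⋂ _ : η < ζ, derivedTree C η := by
      rw [derivedTree, Ordinal.limitRecOn_limit _ _ _ _ hζ]; rfl
    rw [this]
    ext b
    simp only [Set.mem_iInter, Set.mem_ofPred_eq]
    constructor
    · intro h
      have h' : ∀ η < ζ, b ∈ C ∧ η ≤ r b := fun η hη => by
        have := h η hη
        rwa [IH η hη] at this
      refine ⟨(h' 0 hζ.bot_lt).1, le_of_forall_lt fun η hη => ?_⟩
      exact Order.add_one_le_iff.1 (h' (η + 1) (hζ.add_one_lt hη)).2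
    · rintro ⟨hb, h⟩ η hη
      rw [IH η hη]
      exact ⟨hb, hη.le.trans h⟩

variable {D : Type u}

/-- The sequences of pairs whose first entries are strictly decreasing and less than `α`. -/
def decTree (α : Ordinal.{w}) (D : Type u) : Set (List (Ordinal.{w} × D)) :=
  {b | (α :: b.map Prod.fst).IsChain (· > ·)}

/-- The last ordinal of a sequence of pairs, or `α` for the empty sequence. -/
def lastRank (α : Ordinal.{w}) (b : List (Ordinal.{w} × D)) : Ordinal.{w} :=
  (b.map Prod.fst).getLast?.getD α

variable {α : Ordinal.{w}}

theorem lastRank_append (b : List (Ordinal.{w} × D)) (a : Ordinal.{w} × D) :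
    lastRank α (b ++ [a]) = a.1 := by simp [lastRank]

theorem nil_mem_decTree : [] ∈ decTree α D := by simp [decTree]

theorem append_mem_decTree {b : List (Ordinal.{w} × D)} {a : Ordinal.{w} × D} :
    b ++ [a] ∈ decTree α D ↔ b ∈ decTree α D ∧ a.1 < lastRank α b := by
  simp only [decTree, Set.mem_ofPred_eq, List.map_append, List.map_cons, List.map_nil,
    ← List.cons_append, List.isChain_append]
  simp [lastRank, List.getLast?_cons]

theorem mem_decTree_of_prefix {b c : List (Ordinal.{w} × D)} (h : b <+: c)
    (hc : c ∈ decTree α D) : b ∈ decTree α D :=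
  List.IsChain.prefix hc ((List.prefix_cons_inj α).2 (h.map Prod.fst))

theorem lastRank_lt {b c : List (Ordinal.{w} × D)} (hc : c ∈ decTree α D) (h : ProperInit b c) :
    lastRank α c < lastRank α b := by
  obtain ⟨⟨r, rfl⟩, hne⟩ := h
  have hr : r ≠ [] := by rintro rfl; simp at hne
  rw [decTree, Set.mem_ofPred_eq, List.isChain_iff_pairwise, List.map_append, ← List.cons_append,
    List.pairwise_append] at hc
  have hr' : r.map Prod.fst ≠ [] := by simpa using hr
  refine hc.2.2 _ ?_ _ ?_
  · exact List.mem_of_getLast? List.getLast?_cons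
  · rw [lastRank, List.map_append, List.getLast?_append_of_ne_nil _ hr',
      List.getLast?_eq_getLast_of_ne_nil hr', Option.getD_some]
    exact List.getLast_mem hr'

theorem decTree_diff_union : decTree α D \ {[]} ∪ {[]} = decTree α D :=
  Set.sdiff_union_of_subset (Set.singleton_subset_iff.2 nil_mem_decTree)

theorem exists_extension [Nonempty D] {b : List (Ordinal.{w} × D)} (hb : b ∈ decTree α D)
    {ζ : Ordinal.{w}} (hζ : ζ < lastRank α b) :
    ∃ c ∈ decTree α D \ {[]}, ProperInit b c ∧ lastRank α c = ζ :=
  ⟨b ++ [(ζ, Classical.arbitrary D)], ⟨append_mem_decTree.2 ⟨hb, hζ⟩, by simp⟩,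
    ⟨List.prefix_append _ _, by simp⟩, lastRank_append _ _⟩

theorem derivedTree_decTree [Nonempty D] (ζ : Ordinal.{w}) :
    derivedTree (decTree α D) ζ = {b ∈ decTree α D | ζ ≤ lastRank α b} :=
  derivedTree_eq_of_rank (lastRank α) (fun _ _ _ hc h => lastRank_lt hc h)
    (fun b hb ζ hζ => by
      obtain ⟨c, hc, h⟩ := exists_extension hb hζ
      exact ⟨c, hc.1, h⟩) ζ

theorem derivedTree_decTree_diff [Nonempty D] (ζ : Ordinal.{w}) :
    derivedTree (decTree α D \ {[]}) ζ = {b ∈ decTree α D \ {[]} | ζ ≤ lastRank α b} :=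
  derivedTree_eq_of_rank (lastRank α) (fun _ _ _ hc h => lastRank_lt hc.1 h)
    (fun _ hb _ hζ => exists_extension hb.1 hζ) ζ

theorem hasOrder_decTree [Nonempty D] : HasOrder (decTree α D \ {[]}) α := by
  constructor
  · rw [Set.mem_ofPred_eq, derivedTree_decTree_diff, Set.eq_empty_iff_forall_notMem]
    rintro b ⟨hb, h⟩
    have := lastRank_lt hb.1 ⟨List.nil_prefix, fun h' => hb.2 h'.symm⟩
    exact (h.trans_lt this).ne rfl
  · intro ζ hζ
    rw [Set.mem_ofPred_eq, derivedTree_decTree_diff] at hζ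
    by_contra hlt
    obtain ⟨c, hc, -, hcζ⟩ := exists_extension (nil_mem_decTree (D := D)) (not_le.1 hlt)
    have : c ∈ {b ∈ decTree α D \ {[]} | ζ ≤ lastRank α b} := ⟨hc, hcζ.ge⟩
    rw [hζ] at this
    exact this

/-- The node chosen in the extension game at rank `a.1` with label `a.2`. -/
def pick (𝒰 : Filter D) (𝒞 : Set (Set (List (Ordinal.{w} × D)))) (E : D → Set D)
    (a : Ordinal.{w} × D) (S : Set (List (Ordinal.{w} × D))) : List (Ordinal.{w} × D) :=
  Classical.epsilon fun s => LastIn (E a.2) s ∧ Extendable 𝒰 𝒞 a.1 (insert s S)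

/-- A decreasing sequence of ordinals with labels is a run of the opponent's moves; answering each
move gives the node attached to that sequence. All answers along one run lie in a single member of
`𝒞`. -/
theorem Extendable.exists_tree {𝒰 : Filter D} {𝒞 : Set (Set (List (Ordinal.{w} × D)))}
    (h : Extendable 𝒰 𝒞 α ∅) {E : D → Set D} (hE : ∀ U, E U ∈ 𝒰) :
    ∃ d : List (Ordinal.{w} × D) → List (Ordinal.{w} × D), ∀ b ∈ decTree α D,
      (∃ S ∈ 𝒞, ∀ c, c ≠ [] → c <+: b → d c ∈ S) ∧
        ∀ b' a, b = b' ++ [a] → LastIn (E a.2) (d b) := by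
  -- The set of nodes picked along a run; every answer depends on the earlier ones only through this
  -- set.
  let choices : List (Ordinal.{w} × D) → Set (List (Ordinal.{w} × D)) :=
    List.foldl (fun S a => insert (pick 𝒰 𝒞 E a S) S) ∅
  let d : List (Ordinal.{w} × D) → List (Ordinal.{w} × D) := fun b =>
    b.getLast?.elim [] fun a => pick 𝒰 𝒞 E a (choices b.dropLast)
  have hd : ∀ b a, d (b ++ [a]) = pick 𝒰 𝒞 E a (choices b) := fun b a => by simp [d]
  have hchoices : ∀ b a, choices (b ++ [a]) = insert (d (b ++ [a])) (choices b) := fun b a => by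
    rw [hd]; simp [choices]
  have key : ∀ b ∈ decTree α D, Extendable 𝒰 𝒞 (lastRank α b) (choices b) ∧
      (∀ c, c ≠ [] → c <+: b → d c ∈ choices b) ∧
        ∀ b' a, b = b' ++ [a] → LastIn (E a.2) (d b) := by
    intro b
    induction b using List.reverseRecOn with
    | nil =>
      exact fun _ => ⟨h, fun c hc hc' => absurd (List.prefix_nil.1 hc') hc, by simp⟩
    | append_singleton b a IH =>
      intro hb
      obtain ⟨hb, ha⟩ := append_mem_decTree.1 hb
      obtain ⟨h1, h2, -⟩ := IH hb
      have hp : LastIn (E a.2) (d (b ++ [a])) ∧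
          Extendable 𝒰 𝒞 a.1 (insert (d (b ++ [a])) (choices b)) := by
        rw [hd]
        exact Classical.epsilon_spec ((extendable_iff.1 h1).2 _ ha _ (hE a.2))
      refine ⟨?_, fun c hc hcb => ?_, fun b' a' hb' => ?_⟩
      · rw [lastRank_append, hchoices]; exact hp.2
      · rw [hchoices]
        rcases List.prefix_concat_iff.1 hcb with rfl | hcb
        · exact Set.mem_insert _ _
        · exact Set.mem_insert_of_mem _ (h2 c hc hcb)
      · obtain ⟨rfl, h'⟩ := List.append_inj' hb' rfl
        obtain rfl : a = a' := by simpa using h'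
        exact hp.1
  exact ⟨d, fun b hb => ⟨⟨_, (key b hb).1.mem, (key b hb).2.1⟩, (key b hb).2.2⟩⟩

end DecreasingTree

/-! ### Weakly null trees over decreasing sequences, and convex hulls over real or complex scalars
-/

section NullTree

variable {𝕜 : Type k} [RCLike 𝕜] {X : Type u} [NormedAddCommGroup X] [NormedSpace 𝕜 X]

/-- Above a sequence of rank greater than $\zeta$ there is a successor $(\zeta,U)$ of rank exactly
$\zeta$ for every label $U$, and the labels form a weak neighborhood basis. -/
theorem isNullTree_decTree {D : Set (Set (WeakSpace 𝕜 X))} [Nonempty D]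
    (hD : (𝓝 (0 : WeakSpace 𝕜 X)).HasBasis (fun U => U ∈ D) id) (ξ : Ordinal.{w}) {σ : ℝ}
    (hσ : 0 < σ) {z : List (Ordinal.{w} × D) → X}
    (hz : ∀ b ∈ decTree (ω ^ ξ) D, b ≠ [] → ‖z b‖ ≤ 1)
    (hzU : ∀ b a, b ++ [a] ∈ decTree (ω ^ ξ) D → toWeakSpace 𝕜 X (z (b ++ [a])) ∈ a.2.1) :
    IsNullTree 𝕜 ξ σ (decTree (ω ^ ξ) D \ {[]}) fun b => (σ : 𝕜) • z b := by
  refine ⟨⟨by simp, ?_⟩, hasOrder_decTree, ?_, ?_⟩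
  · rw [decTree_diff_union]
    exact fun t ht s hs => mem_decTree_of_prefix hs ht
  · intro ζ t ht
    rw [decTree_diff_union, derivedTree_decTree] at ht
    have hζ : ζ < lastRank (ω ^ ξ) t := Order.add_one_le_iff.1 ht.2
    rw [mem_closure_iff_nhds]
    intro N hN
    have hcont : Tendsto (fun v : WeakSpace 𝕜 X => (σ : 𝕜) • v) (𝓝 0) (𝓝 0) := by
      have := (continuous_const_smul (σ : 𝕜)).tendsto (0 : WeakSpace 𝕜 X)
      rwa [smul_zero] at this
    obtain ⟨U, hU, hUN⟩ := hD.mem_iff.1 (hcont hN)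
    have hmem : t ++ [(ζ, ⟨U, hU⟩)] ∈ decTree (ω ^ ξ) D := append_mem_decTree.2 ⟨ht.1, hζ⟩
    refine ⟨_, ?_, ⟨t ++ [(ζ, ⟨U, hU⟩)], ⟨?_, _, rfl⟩, rfl⟩⟩
    · have := hUN (hzU _ _ hmem)
      simpa using this
    · rw [derivedTree_decTree_diff]
      exact ⟨⟨hmem, by simp⟩, (lastRank_append _ _).ge⟩
  · rintro s ⟨hs, hs0⟩
    rw [norm_smul, RCLike.norm_ofReal, abs_of_pos hσ]
    exact mul_le_of_le_one_right hσ.le (hz s hs hs0)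

theorem le_of_mem_co {φ : X → ℝ} (hadd : ∀ v v', φ (v + v') = φ v + φ v')
    (hsmul : ∀ (r : ℝ) v, φ ((r : 𝕜) • v) = r * φ v) {S : Set X} {c : ℝ}
    (hS : ∀ v ∈ S, c ≤ φ v) {v : X} (hv : v ∈ co 𝕜 S) : c ≤ φ v := by
  let _ : Module ℝ X := Module.compHom X (algebraMap ℝ 𝕜)
  have hs : ∀ (r : ℝ) (v : X), φ (r • v) = r * φ v := fun r v => by
    rw [← hsmul r v, ← RCLike.algebraMap_eq_ofReal]; rfl
  have hconv : Convex ℝ {v : X | c ≤ φ v} := by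
    intro v hv v' hv' a b ha hb hab
    change c ≤ φ (a • v + b • v')
    rw [hadd, hs, hs]
    have h1 := mul_le_mul_of_nonneg_left (show c ≤ φ v from hv) ha
    have h2 := mul_le_mul_of_nonneg_left (show c ≤ φ v' from hv') hb
    calc c = a * c + b * c := by rw [← add_mul, hab, one_mul]
      _ ≤ _ := add_le_add h1 h2
  exact convexHull_min (s := S) (t := {v : X | c ≤ φ v}) hS hconv hv

theorem sum_mem_co {ι : Type*} {s : Finset ι} {r : ι → ℝ} {z : ι → X} {S : Set X}
    (h0 : ∀ i ∈ s, 0 ≤ r i) (h1 : ∑ i ∈ s, r i = 1) (hz : ∀ i ∈ s, z i ∈ S) :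
    ∑ i ∈ s, (r i : 𝕜) • z i ∈ co 𝕜 S := by
  let _ : Module ℝ X := Module.compHom X (algebraMap ℝ 𝕜)
  have := (convex_convexHull ℝ S).sum_mem h0 h1 fun i hi => subset_convexHull ℝ S (hz i hi)
  have heq : ∑ i ∈ s, (r i : 𝕜) • z i = ∑ i ∈ s, r i • z i :=
    Finset.sum_congr rfl fun i _ => by rw [← RCLike.algebraMap_eq_ofReal]; rfl
  rw [heq]
  exact this

end NullTree

/-! ## The smoothness estimate for special convex combinations -/

section Estimate

variable {𝕜 : Type k} [RCLike 𝕜] {X : Type u} [NormedAddCommGroup X] [NormedSpace 𝕜 X]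
  {Y : Type v} [NormedAddCommGroup Y] [NormedSpace 𝕜 Y]

/-- For all weakly null trees of order `ω^ξ` in `σ B_X` the infimum of `‖y + A v‖` over convex
combinations `v` of branches is at most `R`. -/
def HullEstimate (ξ : Ordinal.{w}) (A : X →L[𝕜] Y) (y : Y) (σ R : ℝ) : Prop :=
  ∀ (Λ : Type (max u (w + 1))) (B : Set (List Λ)) (x : List Λ → X), IsNullTree 𝕜 ξ σ B x →
    ∀ c > R, ∃ v ∈ branchHull 𝕜 B x, ‖y + A v‖ < c

/-- The order $\omega^\xi$ is not $0$, so the tree has a member. Nonemptiness is what makes the real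
infimum in the smoothness estimates meaningful, as `sInf ∅ = 0`. -/
theorem IsNullTree.branchHull_nonempty {Λ : Type*} {ξ : Ordinal.{w}} {σ : ℝ} {B : Set (List Λ)}
    {x : List Λ → X} (h : IsNullTree 𝕜 ξ σ B x) : (branchHull 𝕜 B x).Nonempty := by
  have hB : B.Nonempty := by
    rw [Set.nonempty_iff_ne_empty]
    intro hB
    have h0 : (0 : Ordinal.{w}) ∈ {ζ : Ordinal.{w} | derivedTree B ζ = ∅} := by
      rw [Set.mem_ofPred_eq, derivedTree, Ordinal.limitRecOn_zero, hB]
    exact omega0_opow_ne_zero ξ (nonpos_iff_eq_zero.1 (h.2.1.2 h0))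
  obtain ⟨t, ht⟩ := hB
  refine ⟨x t, t, ht, ?_⟩
  let _ : Module ℝ X := Module.compHom X (algebraMap ℝ 𝕜)
  exact subset_convexHull ℝ _ ⟨t, ⟨ht, List.prefix_rfl⟩, rfl⟩

theorem SmoothEstimate.hullEstimate {ξ : Ordinal.{w}} {p : ℝ} (hp : 0 < p) {A : X →L[𝕜] Y}
    {C : ℝ} (h : SmoothEstimate ξ p A C) (y : Y) {σ R : ℝ} (hσ : 0 < σ) (hR : 0 ≤ R)
    (hRp : ‖y‖ ^ p + C * σ ^ p ≤ R ^ p) : HullEstimate ξ A y σ R := by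
  intro Λ B x hB c hc
  by_contra! hcon
  have h1 : c ^ p ≤ sInf ((fun v => ‖y + A v‖ ^ p) '' branchHull 𝕜 B x) := by
    refine le_csInf (hB.branchHull_nonempty.image _) ?_
    rintro _ ⟨v, hv, rfl⟩
    exact Real.rpow_le_rpow (hR.trans hc.le) (hcon v hv) hp.le
  exact absurd (h1.trans ((h Λ B x y σ hσ hB).trans hRp))
    (not_le.2 (Real.rpow_lt_rpow hR hc hp))

theorem SmoothEstimateTop.hullEstimate {ξ : Ordinal.{w}} {A : X →L[𝕜] Y} {C : ℝ}
    (h : SmoothEstimateTop ξ A C) (y : Y) {σ R : ℝ} (hσ : 0 < σ)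
    (hR : max ‖y‖ (C * σ) ≤ R) : HullEstimate ξ A y σ R := by
  intro Λ B x hB c hc
  by_contra! hcon
  have h1 : c ≤ sInf ((fun v => ‖y + A v‖) '' branchHull 𝕜 B x) := by
    refine le_csInf (hB.branchHull_nonempty.image _) ?_
    rintro _ ⟨v, hv, rfl⟩
    exact hcon v hv
  exact absurd (h1.trans ((h Λ B x y σ hσ hB).trans hR)) (not_le.2 hc)

/-- Every weak neighborhood of $0$ contains a member of `D`, so the filter of small sets restricts
to a proper filter on `D`; any finer ultrafilter works. -/
theorem exists_small_ultrafilter {D : Set (Set (WeakSpace 𝕜 X))}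
    (hD : (𝓝 (0 : WeakSpace 𝕜 X)).HasBasis (fun U => U ∈ D) id) :
    ∃ 𝒰 : Ultrafilter D, ∀ U : D, {V : D | V.1 ⊆ U.1} ∈ 𝒰 := by
  have hne : (comap (Subtype.val : D → Set (WeakSpace 𝕜 X)) (𝓝 0).smallSets).NeBot := by
    rw [comap_neBot_iff]
    intro s hs
    obtain ⟨U, hU, hUs⟩ := hD.smallSets.mem_iff.1 hs
    exact ⟨⟨U, hU⟩, hUs (Set.Subset.refl U)⟩
  refine ⟨Ultrafilter.of (comap Subtype.val (𝓝 0).smallSets), fun U => Ultrafilter.of_le _ ?_⟩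
  refine ⟨𝒫 U.1, ?_, fun V hV => hV⟩
  exact eventually_smallSets_subset.2 (hD.mem_of_mem U.2)

/-- The convex combination of the branch `t` of `Γ_ξ D` with the weights `ℙ_ξ`. -/
def branchSum (𝕜 : Type k) [RCLike 𝕜] {X : Type u} [NormedAddCommGroup X] [NormedSpace 𝕜 X]
    (ξ : Ordinal.{w}) {D : Type v} (z : List (Ordinal.{w} × D) → X)
    (t : List (Ordinal.{w} × D)) : X :=
  ∑ j ∈ Finset.Ioc 0 t.length, ((weight ξ ((t.take j).map Prod.fst) : ℝ) : 𝕜) • z (t.take j)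

theorem IsFullBranch.mem_prodTree {Λ D : Type*} {G : Set (List Λ)} {t s : List (Λ × D)}
    (h : IsFullBranch G (t.map Prod.fst)) (hs : s <+: t) (hs0 : s ≠ []) : s ∈ prodTree G D :=
  h.1 _ (by simpa using hs0) (hs.map Prod.fst)

/-- This turns an estimate for some convex combination of some tree into one for the prescribed
combination on almost every branch. On the contrary assumption the average of `f` along `t` is the
whole norm, because `g t` norms the vector and the weights sum to $1$. -/
theorem IsSpecial.eventually_norm_lt {D : Set (Set (WeakSpace 𝕜 X))}
    (hD : (𝓝 (0 : WeakSpace 𝕜 X)).HasBasis (fun U => U ∈ D) id) {𝒰 : Filter D}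
    (h𝒰 : ∀ U : D, {V : D | V.1 ⊆ U.1} ∈ 𝒰) {ξ : Ordinal.{w}}
    {V : Ultrafilter (List (Ordinal.{w} × D))} (hV : IsSpecial 𝒰 ξ V)
    {z : List (Ordinal.{w} × D) → X} (hz : ∀ s ∈ prodTree (gammaTree ξ) D, ‖z s‖ ≤ 1)
    (hzU : ∀ s a, s ++ [a] ∈ prodTree (gammaTree ξ) D → toWeakSpace 𝕜 X (z (s ++ [a])) ∈ a.2.1)
    {A : X →L[𝕜] Y} {y : Y} {σ R c : ℝ} (hσ : 0 < σ) (hR : HullEstimate ξ A y σ R) (hc : R < c) :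
    ∀ᶠ t in V, ‖y + A ((σ : 𝕜) • branchSum 𝕜 ξ z t)‖ < c := by
  by_contra hcon
  rw [← Ultrafilter.eventually_not] at hcon
  have hne : Nonempty D := by
    obtain ⟨U, hU, -⟩ := hD.mem_iff.1 (univ_mem : Set.univ ∈ 𝓝 (0 : WeakSpace 𝕜 X))
    exact ⟨⟨U, hU⟩⟩
  obtain ⟨c₁, hRc₁, hc₁⟩ := exists_between hc
  obtain ⟨c₂, hc₁₂, hc₂⟩ := exists_between hc₁
  choose g hg hg' using fun t => exists_dual_vector'' 𝕜 (y + A ((σ : 𝕜) • branchSum 𝕜 ξ z t))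
  have hre : ∀ t v, RCLike.re (g t v) ≤ ‖v‖ := fun t v =>
    (RCLike.re_le_norm _).trans (((g t).le_opNorm v).trans
      (mul_le_of_le_one_left (norm_nonneg v) (hg t)))
  -- `Spread` asks for a bound on `f` at all pairs, while `z` is bounded only on the tree;
  -- truncation changes nothing there.
  let z' : List (Ordinal.{w} × D) → X := fun s => if ‖z s‖ ≤ 1 then z s else 0
  have hz' : ∀ s, ‖z' s‖ ≤ 1 := fun s => by
    by_cases h : ‖z s‖ ≤ 1
    · simp only [z', if_pos h, h]
    · simp only [z', if_neg h, norm_zero, zero_le_one]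
  have hzz' : ∀ s ∈ prodTree (gammaTree ξ) D, z' s = z s := fun s hs => if_pos (hz s hs)
  let f : List (Ordinal.{w} × D) → List (Ordinal.{w} × D) → ℝ := fun s t =>
    RCLike.re (g t (y + A ((σ : 𝕜) • z' s)))
  have hf : ∀ s t, |f s t| ≤ ‖y‖ + ‖A‖ * σ := fun s t => by
    refine (RCLike.abs_re_le_norm _).trans (((g t).le_opNorm _).trans
      ((mul_le_of_le_one_left (norm_nonneg _) (hg t)).trans ((norm_add_le _ _).trans ?_)))
    refine add_le_add_right ((A.le_opNorm _).trans
      (mul_le_mul_of_nonneg_left ?_ (norm_nonneg _))) _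
    rw [norm_smul, RCLike.norm_ofReal, abs_of_pos hσ]
    exact mul_le_of_le_one_right hσ.le (hz' s)
  have hQ : {t : List (Ordinal.{w} × D) | IsFullBranch (gammaTree ξ) (t.map Prod.fst)} ∈ V := by
    filter_upwards [hV.full] with t ht using ht.1
  have hext := hV.spread f _ c₁ c₂ _ hf hc₁₂ hQ (by
    filter_upwards [hV.full, hV.sum_eq, hcon] with t ht hsum hct
    refine hc₂.trans_le ((not_lt.1 hct).trans_eq ?_)
    have h1 : ‖y + A ((σ : 𝕜) • branchSum 𝕜 ξ z t)‖ =
        RCLike.re (g t (y + A ((σ : 𝕜) • branchSum 𝕜 ξ z t))) := by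
      rw [hg', RCLike.ofReal_re]
    rw [h1, pathSum]
    simp only [f, map_add, mul_add, Finset.sum_add_distrib]
    rw [← Finset.sum_mul, hsum, one_mul, branchSum]
    congr 1
    simp only [map_smul, map_sum]
    rw [Finset.smul_sum, map_sum]
    refine Finset.sum_congr rfl fun j hj => ?_
    rw [hzz' _ (ht.1.mem_prodTree (List.take_prefix j t) (take_ne_nil hj)), smul_comm,
      smul_eq_mul, RCLike.re_ofReal_mul])
  obtain ⟨d, hd⟩ := hext.exists_tree h𝒰
  have hmem : ∀ b ∈ decTree (ω ^ ξ) D, b ≠ [] → d b ∈ prodTree (gammaTree ξ) D := by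
    intro b hb hb0
    obtain ⟨⟨S, ⟨t, ht, hS⟩, hdS⟩, -⟩ := hd b hb
    obtain ⟨h1, h2, -⟩ := hS _ (hdS b hb0 List.prefix_rfl)
    exact IsFullBranch.mem_prodTree ht h1 h2
  have hnull : IsNullTree 𝕜 ξ σ (decTree (ω ^ ξ) D \ {[]}) fun b => (σ : 𝕜) • z (d b) := by
    refine isNullTree_decTree hD ξ hσ (fun b hb hb0 => hz _ (hmem b hb hb0)) fun b a hb => ?_
    have hba := hmem _ hb (by simp)
    -- The last label of the chosen node is contained in the label $U$ of the index, so the vector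
    -- lies in $U$.
    obtain ⟨r, a', hr, ha'⟩ := (hd _ hb).2 b a rfl
    rw [hr] at hba ⊢
    exact ha' (hzU r a' hba)
  obtain ⟨v, ⟨b, hb, hv⟩, hvc⟩ := hR _ _ _ hnull c₁ hRc₁
  obtain ⟨⟨S, ⟨t, ht, hS⟩, hdS⟩, -⟩ := hd b hb.1
  -- Every node along `b` lies on the one branch `t`, so the single functional `g t` bounds the
  -- whole convex hull from below.
  have hle : c₁ - RCLike.re (g t y) ≤ RCLike.re (g t (A v)) := by
    refine le_of_mem_co (𝕜 := 𝕜) (φ := fun v => RCLike.re (g t (A v))) (fun v v' => by simp)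
      (fun r v => by simp) ?_ hv
    rintro _ ⟨s, ⟨hs, hsb⟩, rfl⟩
    obtain ⟨h1, h2, h3⟩ := hS _ (hdS s hs.2 hsb)
    have h4 : f (d s) t = RCLike.re (g t y) + RCLike.re (g t (A ((σ : 𝕜) • z (d s)))) := by
      simp only [f]
      rw [hzz' _ (IsFullBranch.mem_prodTree ht h1 h2), map_add, map_add]
    rw [h4] at h3
    linarith
  have := hre t (y + A v)
  rw [map_add, map_add] at this
  linarith

end Estimate

/-! ## One more block -/

section Step

variable {𝕜 : Type k} [RCLike 𝕜] {X : Type u} [NormedAddCommGroup X] [NormedSpace 𝕜 X]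
  {Y : Type v} [NormedAddCommGroup Y] [NormedSpace 𝕜 Y]

/-- Pointwise estimates for a bounded family of linear maps on a finite-dimensional space are
uniform up to an arbitrarily small error. -/
theorem eventually_forall_norm_le {ι E : Type*} [NormedAddCommGroup E] [NormedSpace 𝕜 E]
    [FiniteDimensional 𝕜 E] {l : Filter ι} {F : ι → E →ₗ[𝕜] Y} {L c c' : ℝ} (hL : 0 ≤ L)
    (hF : ∀ᶠ t in l, ∀ a, ‖F t a‖ ≤ L * ‖a‖) (hcc' : c < c')
    (hc : ∀ a : E, ‖a‖ = 1 → ∀ d > c, ∀ᶠ t in l, ‖F t a‖ < d) :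
    ∀ᶠ t in l, ∀ a, ‖F t a‖ ≤ c' * ‖a‖ := by
  have hprop : ProperSpace E := FiniteDimensional.proper 𝕜 E
  obtain ⟨d, hcd, hdc⟩ := exists_between hcc'
  -- A perturbation of this size moves `F t` by at most $c'-d$; the denominator is $L+1$ because $L$
  -- may vanish.
  have he : 0 < (c' - d) / (L + 1) := div_pos (sub_pos.2 hdc) (by linarith)
  obtain ⟨N, hN, hNfin, hcover⟩ := (isCompact_sphere (0 : E) 1).finite_cover_balls he
  have hNd : ∀ᶠ t in l, ∀ b ∈ N, ‖F t b‖ < d := by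
    rw [hNfin.eventually_all]
    intro b hb
    exact hc b (by simpa using hN hb) d hcd
  filter_upwards [hF, hNd] with t ht htN a
  by_cases ha : a = 0
  · simp [ha]
  have hna : 0 < ‖a‖ := norm_pos_iff.2 ha
  set a₁ : E := ((‖a‖⁻¹ : ℝ) : 𝕜) • a with ha₁
  have hna₁ : ‖a₁‖ = 1 := by
    rw [ha₁, norm_smul, RCLike.norm_ofReal, abs_of_pos (inv_pos.2 hna), inv_mul_cancel₀ hna.ne']
  obtain ⟨b, hb, hab⟩ := Set.mem_iUnion₂.1 (hcover (show a₁ ∈ Metric.sphere (0 : E) 1 by simpa))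
  have h1 : ‖F t a₁‖ ≤ c' := by
    have h2 : F t a₁ = F t (a₁ - b) + F t b := by rw [← map_add, sub_add_cancel]
    have h3 : ‖F t (a₁ - b)‖ ≤ L * ((c' - d) / (L + 1)) :=
      (ht _).trans (mul_le_mul_of_nonneg_left (mem_ball_iff_norm.1 hab).le hL)
    have h4 : L * ((c' - d) / (L + 1)) ≤ c' - d := by
      rw [mul_div_assoc', div_le_iff₀ (by linarith)]
      nlinarith
    rw [h2]
    linarith [norm_add_le (F t (a₁ - b)) (F t b), htN b hb]
  have h5 : a = ((‖a‖ : ℝ) : 𝕜) • a₁ := by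
    rw [ha₁, smul_smul, ← RCLike.ofReal_mul, mul_inv_cancel₀ hna.ne', RCLike.ofReal_one, one_smul]
  have h6 : ‖F t a‖ = ‖a‖ * ‖F t a₁‖ := by
    conv_lhs => rw [h5, map_smul, norm_smul, RCLike.norm_ofReal, abs_of_pos hna]
  rw [h6, mul_comm]
  exact mul_le_mul_of_nonneg_right h1 hna.le

/-- The `ℓ_p` norm of a finite scalar sequence. -/
def seqNorm (p : ENNReal) {n : ℕ} (a : Fin n → 𝕜) : ℝ :=
  ‖(WithLp.toLp p a : PiLp p (fun _ : Fin n => 𝕜))‖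

theorem seqNorm_eq_sum {p : ENNReal} (hp : 0 < p.toReal) {n : ℕ} (a : Fin n → 𝕜) :
    seqNorm p a = (∑ i, ‖a i‖ ^ p.toReal) ^ (1 / p.toReal) := by
  rw [seqNorm, PiLp.norm_eq_sum hp]

theorem seqNorm_rpow {p : ENNReal} (hp : 0 < p.toReal) {n : ℕ} (a : Fin n → 𝕜) :
    seqNorm p a ^ p.toReal = ∑ i, ‖a i‖ ^ p.toReal := by
  rw [seqNorm_eq_sum hp, ← Real.rpow_mul (Finset.sum_nonneg fun i _ => by positivity),
    one_div_mul_cancel hp.ne', Real.rpow_one]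

theorem seqNorm_nonneg {p : ENNReal} [Fact (1 ≤ p)] {n : ℕ} (a : Fin n → 𝕜) : 0 ≤ seqNorm p a :=
  norm_nonneg _

theorem norm_le_seqNorm {p : ENNReal} [Fact (1 ≤ p)] {n : ℕ} (a : Fin n → 𝕜) (i : Fin n) :
    ‖a i‖ ≤ seqNorm p a := PiLp.norm_apply_le (WithLp.toLp p a : PiLp p (fun _ : Fin n => 𝕜)) i

theorem seqNorm_top_le {n : ℕ} {a : Fin n → 𝕜} {r : ℝ} (hr : 0 ≤ r) (h : ∀ i, ‖a i‖ ≤ r) :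
    seqNorm ⊤ a ≤ r := by
  rw [seqNorm, PiLp.norm_eq_ciSup]
  exact Real.iSup_le h hr

theorem seqNorm_castSucc_le {p : ENNReal} [hp : Fact (1 ≤ p)] {n : ℕ} (a : Fin (n + 1) → 𝕜) :
    seqNorm p (fun i : Fin n => a i.castSucc) ≤ seqNorm p a := by
  by_cases hpt : p = ⊤
  · subst hpt
    exact seqNorm_top_le (seqNorm_nonneg a) fun i => norm_le_seqNorm a _
  · have hp0 : 0 < p.toReal := ENNReal.toReal_pos (zero_lt_one.trans_le hp.out).ne' hpt
    rw [← Real.rpow_le_rpow_iff (seqNorm_nonneg _) (seqNorm_nonneg _) hp0, seqNorm_rpow hp0,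
      seqNorm_rpow hp0, Fin.sum_univ_castSucc]
    exact le_add_of_nonneg_right (Real.rpow_nonneg (norm_nonneg _) _)

/-- The estimate `HullEstimate` for perturbations of a vector `y` that is controlled by a sequence
of scalars, with a constant not less than `K`. -/
def SequenceEstimate (ξ : Ordinal.{w}) (p : ENNReal) (A : X →L[𝕜] Y) (K : ℝ) : Prop :=
  ∀ (n : ℕ) (a : Fin (n + 1) → 𝕜) (K' : ℝ) (y : Y), K ≤ K' → a (Fin.last n) ≠ 0 →
    ‖y‖ ≤ K' * seqNorm p (fun i : Fin n => a i.castSucc) →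
    HullEstimate ξ A y ‖a (Fin.last n)‖ (K' * seqNorm p a)

/-- After taking $p$-th powers, $K'^p\sum_{i<n}|a_i|^p+K^p|a_n|^p\le K'^p\sum_{i\le n}|a_i|^p$.
Allowing $K'\ge K$ leaves room for the constant to grow from block to block. -/
theorem SmoothEstimate.sequenceEstimate {ξ : Ordinal.{w}} {p : ENNReal} [hp : Fact (1 ≤ p)]
    (hpt : p ≠ ⊤) {A : X →L[𝕜] Y} {K : ℝ} (hK : 0 ≤ K)
    (h : SmoothEstimate ξ p.toReal A (K ^ p.toReal)) : SequenceEstimate ξ p A K := by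
  intro n a K' y hK' ha hy
  have hp0 : 0 < p.toReal := ENNReal.toReal_pos (zero_lt_one.trans_le hp.out).ne' hpt
  have hK'0 : 0 ≤ K' := hK.trans hK'
  refine h.hullEstimate hp0 y (norm_pos_iff.2 ha) (mul_nonneg hK'0 (seqNorm_nonneg a)) ?_
  rw [Real.mul_rpow hK'0 (seqNorm_nonneg a), seqNorm_rpow hp0, Fin.sum_univ_castSucc, mul_add]
  refine add_le_add ?_ (mul_le_mul_of_nonneg_right (Real.rpow_le_rpow hK hK' hp0.le)
    (Real.rpow_nonneg (norm_nonneg _) _))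
  rw [← seqNorm_rpow hp0 (fun i : Fin n => a i.castSucc),
    ← Real.mul_rpow hK'0 (seqNorm_nonneg _)]
  exact Real.rpow_le_rpow (norm_nonneg y) hy hp0.le

theorem SmoothEstimateTop.sequenceEstimate {ξ : Ordinal.{w}} {A : X →L[𝕜] Y} {K : ℝ} (hK : 0 ≤ K)
    (h : SmoothEstimateTop ξ A K) : SequenceEstimate ξ ⊤ A K := by
  intro n a K' y hK' ha hy
  have hK'0 : 0 ≤ K' := hK.trans hK'
  refine h.hullEstimate y (norm_pos_iff.2 ha) (max_le ?_ ?_)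
  · exact hy.trans (mul_le_mul_of_nonneg_left (seqNorm_castSucc_le a) hK'0)
  · exact mul_le_mul hK' (norm_le_seqNorm a _) (norm_nonneg _) hK'0

theorem norm_branchSum_le {ξ : Ordinal.{w}} {D : Type u} {z : List (Ordinal.{w} × D) → X}
    {t : List (Ordinal.{w} × D)} (hz : ∀ s ∈ prodTree (gammaTree ξ) D, ‖z s‖ ≤ 1)
    (ht : IsFullBranch (gammaTree ξ) (t.map Prod.fst))
    (hsum : ∑ j ∈ Finset.Ioc 0 t.length, weight ξ ((t.take j).map Prod.fst) = 1) :
    ‖branchSum 𝕜 ξ z t‖ ≤ 1 := by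
  rw [branchSum, ← hsum]
  refine norm_sum_le_of_le _ fun j hj => ?_
  rw [norm_smul, RCLike.norm_ofReal, abs_of_nonneg (weight_nonneg _ _)]
  exact mul_le_of_le_one_right (weight_nonneg _ _)
    (hz _ (ht.mem_prodTree (List.take_prefix j t) (take_ne_nil hj)))

/-- For each fixed unit vector of scalars any bound above $K_1$ holds almost surely; the gap up to
$K_2$ pays for the passage to all scalars through a finite net. -/
theorem IsSpecial.eventually_dominated {D : Set (Set (WeakSpace 𝕜 X))}
    (hD : (𝓝 (0 : WeakSpace 𝕜 X)).HasBasis (fun U => U ∈ D) id) {𝒰 : Filter D}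
    (h𝒰 : ∀ U : D, {V : D | V.1 ⊆ U.1} ∈ 𝒰) {ξ : Ordinal.{w}}
    {V : Ultrafilter (List (Ordinal.{w} × D))} (hV : IsSpecial 𝒰 ξ V)
    {z : List (Ordinal.{w} × D) → X} (hz : ∀ s ∈ prodTree (gammaTree ξ) D, ‖z s‖ ≤ 1)
    (hzU : ∀ s a, s ++ [a] ∈ prodTree (gammaTree ξ) D → toWeakSpace 𝕜 X (z (s ++ [a])) ∈ a.2.1)
    {A : X →L[𝕜] Y} {p : ENNReal} [Fact (1 ≤ p)] {K K₁ K₂ : ℝ} (hK : 0 ≤ K)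
    (hA : SequenceEstimate ξ p A K) (hK₁ : K ≤ K₁) (hK₂ : K₁ < K₂) {n : ℕ} {v : Fin n → Y}
    (hv : ∀ a : Fin n → 𝕜, ‖∑ i, a i • v i‖ ≤ K₁ * seqNorm p a) :
    ∀ᶠ t in V, ∀ a : Fin (n + 1) → 𝕜,
      ‖∑ i : Fin n, a i.castSucc • v i + a (Fin.last n) • A (branchSum 𝕜 ξ z t)‖ ≤
        K₂ * seqNorm p a := by
  let F : List (Ordinal.{w} × D) → PiLp p (fun _ : Fin (n + 1) => 𝕜) →ₗ[𝕜] Y := fun t =>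
    (Fintype.linearCombination 𝕜 (Fin.snoc (α := fun _ => Y) v (A (branchSum 𝕜 ξ z t)))).comp
      (WithLp.linearEquiv p 𝕜 (Fin (n + 1) → 𝕜)).toLinearMap
  have hF : ∀ t (a : PiLp p (fun _ : Fin (n + 1) => 𝕜)), F t a =
      ∑ i : Fin n, a i.castSucc • v i + a (Fin.last n) • A (branchSum 𝕜 ξ z t) := by
    intro t a
    simp [F, Fintype.linearCombination_apply, Fin.sum_univ_castSucc]
  have hbound : ∀ᶠ t in V, ∀ a, ‖F t a‖ ≤ (∑ i, ‖v i‖ + ‖A‖) * ‖a‖ := by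
    filter_upwards [hV.full, hV.sum_eq] with t ht hsum a
    have hle := norm_branchSum_le (𝕜 := 𝕜) hz ht.1 hsum
    rw [hF, add_mul, Finset.sum_mul]
    refine (norm_add_le _ _).trans (add_le_add (norm_sum_le_of_le _ fun i _ => ?_) ?_)
    · rw [norm_smul, mul_comm]
      exact mul_le_mul_of_nonneg_left (PiLp.norm_apply_le a _) (norm_nonneg _)
    · rw [norm_smul, mul_comm]
      exact mul_le_mul ((A.le_opNorm _).trans (mul_le_of_le_one_right (norm_nonneg A) hle))
        (PiLp.norm_apply_le a _) (norm_nonneg _) (norm_nonneg _)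
  have hpt : ∀ a : PiLp p (fun _ : Fin (n + 1) => 𝕜), ‖a‖ = 1 → ∀ d > K₁,
      ∀ᶠ t in V, ‖F t a‖ < d := by
    intro a ha d hd
    have hseq : seqNorm p (a : Fin (n + 1) → 𝕜) = 1 := ha
    have hy := hv fun i => a i.castSucc
    simp only [hF]
    by_cases h0 : a (Fin.last n) = 0
    · refine Eventually.of_forall fun t => ?_
      rw [h0, zero_smul, add_zero]
      have := mul_le_mul_of_nonneg_left (seqNorm_castSucc_le (p := p) (a : Fin (n + 1) → 𝕜))
        (hK.trans hK₁)
      rw [hseq, mul_one] at this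
      exact (hy.trans this).trans_lt hd
    · have hpos : 0 < ‖a (Fin.last n)‖ := norm_pos_iff.2 h0
      -- Dividing by this unimodular scalar makes the last coefficient a positive real $\sigma$, as
      -- the hull estimate requires.
      set θ : 𝕜 := a (Fin.last n) / (‖a (Fin.last n)‖ : 𝕜) with hθ
      have hnθ : ‖θ‖ = 1 := by
        rw [hθ, norm_div, RCLike.norm_ofReal, abs_of_pos hpos, div_self hpos.ne']
      have hθ0 : θ ≠ 0 := by rw [← norm_pos_iff, hnθ]; exact one_pos
      have hest := hA n a K₁ (θ⁻¹ • ∑ i : Fin n, a i.castSucc • v i) hK₁ h0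
        (by rw [norm_smul, norm_inv, hnθ, inv_one, one_mul]; exact hy)
      have := hV.eventually_norm_lt hD h𝒰 hz hzU hpos hest
        (show K₁ * seqNorm p (a : Fin (n + 1) → 𝕜) < d by rwa [hseq, mul_one])
      filter_upwards [this] with t ht
      refine lt_of_eq_of_lt ?_ ht
      rw [← one_mul ‖θ⁻¹ • _ + _‖, ← hnθ, ← norm_smul, smul_add, smul_inv_smul₀ hθ0, map_smul,
        smul_smul, hθ, div_mul_cancel₀]
      exact RCLike.ofReal_ne_zero.2 hpos.ne'
  have := eventually_forall_norm_le (by positivity) hbound hK₂ hpt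
  filter_upwards [this] with t ht a
  have := ht (WithLp.toLp p a)
  rwa [hF] at this

end Step

/-! ## Levels of `Γ_{ξ,∞}` -/

section Levels

variable {ξ : Ordinal.{w}} {n : ℕ}

theorem gammaInfLevel_bounds {s : List Ordinal.{w}} (hs : s ∈ gammaInfLevel ξ n) :
    ∀ a ∈ s, a < ω ^ ξ * n := by
  induction n generalizing s with
  | zero =>
    obtain rfl : s = [] := hs
    simp
  | succ n IH =>
    obtain ⟨r, hr, u, hu, rfl⟩ := hs
    intro a ha
    rcases List.mem_append.1 ha with ha | ha
    · exact (IH hr.1 a ha).trans_le (mul_le_mul_right (by exact_mod_cast n.le_succ) _)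
    · have := (mem_shift_bounds (gammaTree_bounds ξ u hu).2 a ha).2
      push_cast; exact this

/-- In a longer member of the level, the part preceding the last block is comparable with `s`, and
both are maximal in the previous level; hence they agree and the last blocks can be compared. -/
theorem append_mem_maxSet_gammaInfLevel {s u : List Ordinal.{w}}
    (hs : s ∈ maxSet (gammaInfLevel ξ n)) (hu : IsFullBranch (gammaTree ξ) u) (hu0 : u ≠ []) :
    s ++ shift (ω ^ ξ * n) u ∈ maxSet (gammaInfLevel ξ (n + 1)) := by
  refine ⟨⟨s, hs, u, hu.1 u hu0 List.prefix_rfl, rfl⟩, ?_⟩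
  rintro _ ⟨r, hr, u', hu', rfl⟩ h
  have hrs : r = s := by
    rcases List.prefix_or_prefix_of_prefix ((List.prefix_append _ _).trans h.1)
      (List.prefix_append r (shift (ω ^ ξ * n) u')) with h' | h' <;> by_contra hne
    · exact hs.2 r hr.1 ⟨h', Ne.symm hne⟩
    · exact hr.2 s hs.1 ⟨h', hne⟩
  subst hrs
  refine hu.2 u' hu' ⟨shift_prefix_shift.1 ((List.prefix_append_right_inj _).1 h.1), ?_⟩
  rintro rfl
  exact h.2 rfl

theorem mem_maxSet_prodTree {Λ D : Type*} {S : Set (List Λ)} {t : List (Λ × D)}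
    (ht : t.map Prod.fst ∈ maxSet S) : t ∈ maxSet (prodTree S D) := by
  refine ⟨ht.1, fun s hs h => ht.2 _ hs ⟨h.1.map Prod.fst, fun heq => h.2 ?_⟩⟩
  refine h.1.eq_of_length ?_
  simpa using congrArg List.length heq

variable {𝕜 : Type k} [RCLike 𝕜] {X : Type u} [NormedAddCommGroup X] [NormedSpace 𝕜 X]
  {D : Type v}

/-- The block of the collection `x` above `s`, as a collection on `Γ_ξ D`. -/
def blockAbove (ξ : Ordinal.{w}) (n : ℕ) (x : List (Ordinal.{w} × D) → X)
    (s u : List (Ordinal.{w} × D)) : X := x (s ++ u.map (shiftFst (ω ^ ξ * n)))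

theorem append_mem_omegaInf {s u : List (Ordinal.{w} × D)}
    (hs : s.map Prod.fst ∈ maxSet (gammaInfLevel ξ n)) (hu : u ∈ prodTree (gammaTree ξ) D) :
    s ++ u.map (shiftFst (ω ^ ξ * n)) ∈ omegaInf ξ D := by
  refine Set.mem_iUnion.2 ⟨n, s.map Prod.fst, hs, u.map Prod.fst, hu, ?_⟩
  rw [List.map_append, map_fst_map_shiftFst]

theorem iota_append_block {s u : List (Ordinal.{w} × D)}
    (hs : s.map Prod.fst ∈ maxSet (gammaInfLevel ξ n)) (hu : u ∈ prodTree (gammaTree ξ) D) :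
    iota ξ ((s ++ u.map (shiftFst (ω ^ ξ * n))).map Prod.fst) = u.map Prod.fst := by
  have hb := gammaTree_bounds ξ _ hu
  rw [List.map_append, map_fst_map_shiftFst, iota_append, iota_shift _ hb.2]
  · simpa [shift] using hb.1
  · intro a ha b hb'
    have h1 : a / ω ^ ξ < n := (Ordinal.lt_mul_iff_div_lt (omega0_opow_ne_zero ξ)).1
      (gammaInfLevel_bounds hs.1 a ha)
    have h2 : (n : Ordinal.{w}) ≤ b / ω ^ ξ :=
      (Ordinal.mul_le_iff_le_div (omega0_opow_ne_zero ξ)).1 (mem_shift_bounds hb.2 b hb').1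
    exact (h1.trans_le h2).ne

theorem specialSum_append (x : List (Ordinal.{w} × D) → X) {s u : List (Ordinal.{w} × D)}
    (hs : s.map Prod.fst ∈ maxSet (gammaInfLevel ξ n))
    (hu : IsFullBranch (gammaTree ξ) (u.map Prod.fst)) :
    specialSum 𝕜 ξ x s (s ++ u.map (shiftFst (ω ^ ξ * n))) =
      branchSum 𝕜 ξ (blockAbove ξ n x s) u := by
  rw [specialSum, sum_Ioc_length_append_right
    (fun r => ((weight ξ (iota ξ (r.map Prod.fst)) : ℝ) : 𝕜) • x r), List.length_map, branchSum]
  refine Finset.sum_congr rfl fun j hj => ?_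
  rw [← List.map_take, iota_append_block hs (map_fst_take_mem hu hj), blockAbove]

theorem specialSum_mem_co (x : List (Ordinal.{w} × D) → X) {s u : List (Ordinal.{w} × D)}
    (hs : s.map Prod.fst ∈ maxSet (gammaInfLevel ξ n))
    (hu : IsFullBranch (gammaTree ξ) (u.map Prod.fst))
    (hsum : ∑ j ∈ Finset.Ioc 0 u.length, weight ξ ((u.take j).map Prod.fst) = 1) :
    specialSum 𝕜 ξ x s (s ++ u.map (shiftFst (ω ^ ξ * n))) ∈
      co 𝕜 (x '' {r | ProperInit s r ∧ r <+: s ++ u.map (shiftFst (ω ^ ξ * n))}) := by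
  rw [specialSum_append x hs hu]
  refine sum_mem_co (fun _ _ => weight_nonneg _ _) hsum fun j hj => ?_
  refine ⟨_, ⟨⟨List.prefix_append _ _, ?_⟩, ?_⟩, rfl⟩
  · have := take_ne_nil hj
    simpa using this
  · exact (List.prefix_append_right_inj s).2 ((List.take_prefix j u).map _)

end Levels

/-- `P n` looks only at the terms up to $n$, which later updates never change, so the diagonal
sequence satisfies every `P n`. -/
theorem exists_seq_of_step {α : Type*} {P : ℕ → (ℕ → α) → Prop}
    (hP : ∀ n h h', (∀ i ≤ n, h i = h' i) → P n h → P n h') {h₀ : ℕ → α} (h0 : P 0 h₀)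
    (hstep : ∀ n h, P n h → ∃ a, P (n + 1) (Function.update h (n + 1) a)) :
    ∃ h, ∀ n, P n h := by
  choose a ha using hstep
  let H : (n : ℕ) → {h // P n h} := fun n =>
    Nat.rec ⟨h₀, h0⟩ (fun n h => ⟨Function.update h.1 (n + 1) (a n h.1 h.2), ha n h.1 h.2⟩) n
  have hH : ∀ n i, i ≤ n → (H n).1 i = (H i).1 i := by
    intro n
    induction n with
    | zero => intro i hi; rw [Nat.le_zero.1 hi]
    | succ n IH =>
      intro i hi
      rcases Nat.lt_or_eq_of_le hi with hi | rfl
      · rw [← IH i (Nat.lt_succ_iff.1 hi)]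
        exact Function.update_of_ne hi.ne _ _
      · rfl
  exact ⟨fun n => (H n).1 n, fun n => hP n (H n).1 _ (fun i hi => hH n i hi) (H n).2⟩

/-! ### The constant and the inductive choice of the blocks -/

section Main

variable {𝕜 : Type k} [RCLike 𝕜] {X : Type u} [NormedAddCommGroup X] [NormedSpace 𝕜 X]
  {Y : Type v} [NormedAddCommGroup Y] [NormedSpace 𝕜 Y]

/-- The infimum defining $\mathbf t_{\xi,p}(A)$ supplies an admissible $C<C_1^p$, and $K=C^{1/p}$;
for $p=\infty$, $K=C$. -/
theorem exists_sequenceEstimate {ξ : Ordinal.{w}} {p : ENNReal} [hp : Fact (1 ≤ p)]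
    {A : X →L[𝕜] Y} {C₁ : ℝ}
    (hC₁ : (if p = ⊤ then tConst ξ p A else tConst ξ p A ^ (1 / p.toReal)) < ENNReal.ofReal C₁) :
    ∃ K, 0 ≤ K ∧ K < C₁ ∧ SequenceEstimate ξ p A K := by
  have hC₁0 : 0 < C₁ := ENNReal.ofReal_pos.1 (zero_le.trans_lt hC₁)
  by_cases hpt : p = ⊤
  · subst hpt
    rw [if_pos rfl, tConst, sInf_lt_iff] at hC₁
    obtain ⟨_, ⟨C, hC0, rfl, hC⟩, hlt⟩ := hC₁
    rw [if_pos rfl] at hC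
    exact ⟨C, hC0.le, (ENNReal.ofReal_lt_ofReal_iff hC₁0).1 hlt, hC.sequenceEstimate hC0.le⟩
  · have hp0 : 0 < p.toReal := ENNReal.toReal_pos (zero_lt_one.trans_le hp.out).ne' hpt
    rw [if_neg hpt, one_div, ENNReal.rpow_inv_lt_iff hp0, tConst, sInf_lt_iff,
      ENNReal.ofReal_rpow_of_pos hC₁0] at hC₁
    obtain ⟨_, ⟨C, hC0, rfl, hC⟩, hlt⟩ := hC₁
    rw [if_neg hpt] at hC
    have hlt' : C < C₁ ^ p.toReal :=
      (ENNReal.ofReal_lt_ofReal_iff (Real.rpow_pos_of_pos hC₁0 _)).1 hlt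
    have hCK : (C ^ p.toReal⁻¹) ^ p.toReal = C := by
      rw [← Real.rpow_mul hC0.le, inv_mul_cancel₀ hp0.ne', Real.rpow_one]
    have hK0 : 0 ≤ C ^ p.toReal⁻¹ := Real.rpow_nonneg hC0.le _
    refine ⟨C ^ p.toReal⁻¹, hK0, ?_, ?_⟩
    · rwa [← Real.rpow_lt_rpow_iff hK0 hC₁0.le hp0, hCK]
    · exact SmoothEstimate.sequenceEstimate hpt hK0 (by rwa [hCK])

theorem exists_dominated_sequence {ξ : Ordinal.{w}} {p : ENNReal} [Fact (1 ≤ p)]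
    {A : X →L[𝕜] Y} {D : Set (Set (WeakSpace 𝕜 X))}
    (hD : (𝓝 (0 : WeakSpace 𝕜 X)).HasBasis (fun U => U ∈ D) id)
    {x : List (Ordinal.{w} × D) → X} (hxB : ∀ t ∈ omegaInf ξ D, ‖x t‖ ≤ 1)
    (hx : NormallyWeaklyNull 𝕜 ξ x) {K C₁ : ℝ} (hK : 0 ≤ K) (hKC : K < C₁)
    (hA : SequenceEstimate ξ p A K) :
    ∃ t : ℕ → List (Ordinal.{w} × D),
      t 0 = [] ∧
      (∀ n, ProperInit (t n) (t (n + 1))) ∧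
      (∀ n, 1 ≤ n → t n ∈ maxSet (omegaInfLevel ξ D n)) ∧
      (∀ n, specialSum 𝕜 ξ x (t n) (t (n + 1)) ∈
        co 𝕜 (x '' {s | ProperInit (t n) s ∧ s <+: t (n + 1)})) ∧
      Dominated 𝕜 p C₁ (fun n => A (specialSum 𝕜 ξ x (t n) (t (n + 1)))) := by
  obtain ⟨𝒰, h𝒰⟩ := exists_small_ultrafilter hD
  obtain ⟨V, hV⟩ := exists_isSpecial 𝒰 ξ
  -- These constants increase strictly from $K$ towards $C_1$, so every block has some slack and the
  -- total stays within $C_1$.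
  let κ : ℕ → ℝ := fun n => C₁ - (C₁ - K) / 2 ^ n
  have hκ_lt : ∀ n, κ n < κ (n + 1) := fun n => by
    refine sub_lt_sub_left (div_lt_div_of_pos_left (sub_pos.2 hKC) (by positivity) ?_) _
    exact pow_lt_pow_right₀ one_lt_two (Nat.lt_succ_self n)
  have hκ_ge : ∀ n, K ≤ κ n := fun n => by
    have : (C₁ - K) / 2 ^ n ≤ C₁ - K :=
      div_le_self (sub_pos.2 hKC).le (one_le_pow₀ one_le_two)
    simp only [κ]; linarith
  have hκ_le : ∀ n, κ n ≤ C₁ := fun n =>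
    sub_le_self _ (div_nonneg (sub_pos.2 hKC).le (by positivity))
  let Q : ℕ → List (Ordinal.{w} × D) → List (Ordinal.{w} × D) → Prop := fun n s t =>
    ProperInit s t ∧ specialSum 𝕜 ξ x s t ∈ co 𝕜 (x '' {r | ProperInit s r ∧ r <+: t})
  let P : ℕ → (ℕ → List (Ordinal.{w} × D)) → Prop := fun n h =>
    h 0 = [] ∧ (h n).map Prod.fst ∈ maxSet (gammaInfLevel ξ n) ∧
      (∀ i < n, Q i (h i) (h (i + 1))) ∧
      ∀ a : Fin n → 𝕜, ‖∑ i, a i • A (specialSum 𝕜 ξ x (h i) (h (i + 1)))‖ ≤ κ n * seqNorm p a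
  have hP : ∀ n h h', (∀ i ≤ n, h i = h' i) → P n h → P n h' := by
    rintro n h h' heq ⟨h1, h2, h3, h4⟩
    refine ⟨by rw [← heq 0 (Nat.zero_le n), h1], by rwa [← heq n le_rfl], fun i hi => ?_,
      fun a => ?_⟩
    · rw [← heq i hi.le, ← heq (i + 1) hi]
      exact h3 i hi
    · convert h4 a using 6 with i
      · exact (heq i i.2.le).symm
      · exact (heq (i + 1) i.2).symm
  have hstep : ∀ n h, P n h → ∃ t, P (n + 1) (Function.update h (n + 1) t) := by
    rintro n h ⟨h1, h2, h3, h4⟩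
    have hz : ∀ s ∈ prodTree (gammaTree ξ) D, ‖blockAbove ξ n x (h n) s‖ ≤ 1 := fun s hs =>
      hxB _ (append_mem_omegaInf h2 hs)
    have hzU : ∀ s a, s ++ [a] ∈ prodTree (gammaTree ξ) D →
        toWeakSpace 𝕜 X (blockAbove ξ n x (h n) (s ++ [a])) ∈ a.2.1 := by
      intro s a hs
      refine hx _ (append_mem_omegaInf h2 hs) (h n ++ s.map (shiftFst (ω ^ ξ * n)))
        (ω ^ ξ * n + a.1) a.2 ?_
      rw [List.map_append, ← List.append_assoc]
      rfl
    obtain ⟨u, hdom, hfull, hsum⟩ := ((hV.eventually_dominated hD h𝒰 hz hzU hK hA (hκ_ge n)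
      (hκ_lt n) h4).and (hV.full.and hV.sum_eq)).exists
    have hupd : ∀ i ≤ n, Function.update h (n + 1) (h n ++ u.map (shiftFst (ω ^ ξ * n))) i = h i :=
      fun i hi => Function.update_of_ne (Nat.lt_succ_of_le hi).ne _ _
    refine ⟨h n ++ u.map (shiftFst (ω ^ ξ * n)), ?_, ?_, fun i hi => ?_, fun a => ?_⟩
    · rw [hupd 0 (Nat.zero_le n), h1]
    · rw [Function.update_self, List.map_append, map_fst_map_shiftFst]
      exact append_mem_maxSet_gammaInfLevel h2 hfull.1 (by simpa using hfull.2)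
    · rw [hupd i (Nat.lt_succ_iff.1 hi)]
      rcases Nat.lt_or_eq_of_le (Nat.lt_succ_iff.1 hi) with hi | rfl
      · rw [hupd (i + 1) hi]
        exact h3 i hi
      · rw [Function.update_self]
        refine ⟨⟨List.prefix_append _ _, ?_⟩, specialSum_mem_co x h2 hfull.1 hsum⟩
        simpa using hfull.2
    · refine le_of_eq_of_le ?_ (hdom a)
      rw [Fin.sum_univ_castSucc, Fin.val_last, hupd n le_rfl, Function.update_self,
        specialSum_append x h2 hfull.1]
      congr 2
      refine Finset.sum_congr rfl fun i _ => ?_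
      rw [Fin.val_castSucc, hupd i i.2.le, hupd (i + 1) i.2]
  obtain ⟨t, ht⟩ := exists_seq_of_step hP (h₀ := fun _ => []) (by
    refine ⟨rfl, ⟨rfl, ?_⟩, fun i hi => absurd hi (Nat.not_lt_zero i), fun a => ?_⟩
    · rintro s rfl h
      exact h.2 rfl
    · simpa using mul_nonneg (hK.trans (hκ_ge 0)) (seqNorm_nonneg a)) hstep
  refine ⟨t, (ht 0).1, fun n => ((ht (n + 1)).2.2.1 n n.lt_succ_self).1,
    fun n _ => mem_maxSet_prodTree (ht n).2.1,
    fun n => ((ht (n + 1)).2.2.1 n n.lt_succ_self).2, fun n a => ?_⟩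
  exact ((ht n).2.2.2 a).trans (mul_le_mul_of_nonneg_right (hκ_le n) (seqNorm_nonneg a))

end Main

end XiAUS

end

open XiAUS
theorem mainTheorem8 {𝕜 : Type k} [RCLike 𝕜]
    {X : Type u} [NormedAddCommGroup X] [NormedSpace 𝕜 X] [CompleteSpace X]
    {Y : Type v} [NormedAddCommGroup Y] [NormedSpace 𝕜 Y] [CompleteSpace Y]
    (ξ : Ordinal.{w}) (p : ENNReal) (hp : 1 < p)
    (A : X →L[𝕜] Y) (hA : IsAUSPowerType ξ p A)
    (D : Set (Set (WeakSpace 𝕜 X)))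
    (hD : (𝓝 (0 : WeakSpace 𝕜 X)).HasBasis (fun U => U ∈ D) id)
    (x : List (Ordinal.{w} × D) → X) (hxB : ∀ t ∈ omegaInf ξ D, ‖x t‖ ≤ 1)
    (hx : NormallyWeaklyNull 𝕜 ξ x)
    (C₁ : ℝ)
    (hC₁ : (if p = ⊤ then tConst ξ p A else tConst ξ p A ^ (1 / p.toReal)) < ENNReal.ofReal C₁) :
    ∃ t : ℕ → List (Ordinal.{w} × D),
      t 0 = [] ∧
      (∀ n, ProperInit (t n) (t (n + 1))) ∧
      (∀ n, 1 ≤ n → t n ∈ maxSet (omegaInfLevel ξ D n)) ∧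
      (∀ n, specialSum 𝕜 ξ x (t n) (t (n + 1)) ∈
        co 𝕜 (x '' {s | ProperInit (t n) s ∧ s <+: t (n + 1)})) ∧
      Dominated 𝕜 p C₁ (fun n => A (specialSum 𝕜 ξ x (t n) (t (n + 1)))) := by
  have : Fact (1 ≤ p) := ⟨hp.le⟩
  obtain ⟨K, hK, hKC, hest⟩ := exists_sequenceEstimate hC₁
  exact exists_dominated_sequence hD hxB hx hK hKC hest
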